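/- Let $A=\{a_1,\dots,a_n\}$ be a finite linearly ordered alphabet, let $A^*$ (resp. $A^+$) be the set of all (resp. all non-empty) words over $A$, and order $A^*$ by the deg-lex ordering $<$ (first by length, then lexicographically). Let $k\ge 2$, let $u,v\in A^+$ be words of length $k$ with $u>v$, and let $S=\mathrm{sgp}^+\langle A\mid u=v\rangle$ be the quotient of the free semigroup $A^+$ by the congruence generated by $(u,v)$. Let $F$ be a field and assume that $\{u-v\}$ is a Gröbner–Shirshov basis in the free associative algebra $F\langle A\rangle$ with respect to $<$, i.e. every intersection or inclusion composition of $u-v$ with itself, with ambiguity $w$, is an $F$-linear combination of elements $c(u-v)d$ with $c,d\in A^*$ and $cud<w$. For a word $x$ and $t\ge 1$ let $x(t)$ and $x[t]$ denote the prefix and the suffix of $x$ of length $t$ (both equal to $x$ if $t>|x|$), and let $\mathrm{con}(x)$ be the set of letters occurring in $x$. Suppose that at least one of the following holds: 1. for all $t\ge 1$, $v(t)\ne u[t]$ and $v[t]\ne u(t)$ as words; 2. $|\mathrm{con}(u)|=k$; 3. $k=2$; 4. $\mathrm{con}(u)\not\subseteq \mathrm{con}(v)$; 5. $u$ is not of the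 form $ww'w$ and $v$ is not of the form $ss's$, with $w,s\in A^+$ and $w',s'\in A^*$. Then $S$ is biautomatic and prefix-automatic. Here, for a finite alphabet $B$, a language $L\subseteq B^+$ and a homomorphism $\varphi:B^+\to S$, let $\delta^R$ (resp. $\delta^L$) be the map that sends a pair of words to a word over $B(2,\$)=((B\cup\{\$\})\times(B\cup\{\$\}))\setminus\{(\$,\$)\}$ by padding the shorter word with $\$$ on the right (resp. on the left). $S$ is *biautomatic* if there are a finite alphabet $B$, a regular $L\subseteq B^+$ and a homomorphism $\varphi:B^+\to S$ with $\varphi(L)=S$ such that for every $a\in B\cup\{\varepsilon\}$ (where $\varepsilon$ is the empty word) the four languages $\{(\alpha,\beta)\delta:\alpha,\beta\in L,\ \varphi(a\alpha)=\varphi(\beta)\}$ and $\{(\alpha,\beta)\delta:\alpha,\beta\in L,\ \varphi(\alpha a)=\varphi(\beta)\}$, $\delta\in\{\delta^L,\delta^R\}$, are regular. $S$ is *prefix-automatic* if there are such $B,L,\varphi$ for which $\{(\alpha,\beta)\delta^R:\alpha,\beta\in L,\ \varphi(\alpha a)=\varphi(\beta)\}$ is regular for every $a\in B\cup\{\varepsilon\}$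 and $\{(\alpha,\beta)\delta^R:\alpha\in L,\ \beta\text{ a non-empty prefix of a word of }L,\ \varphi(\alpha)=\varphi(\beta)\}$ is regular. -/

import Mathlib

namespace OneRelator

universe u

/-! ### Words and regular languages -/

/-- The word (a nonempty list of letters) underlying an element of the free semigroup `A⁺`. -/
def word {A : Type u} (w : FreeSemigroup A) : List A := w.head :: w.tail

/-- `α(t)`: the prefix of length `t` of a word, the whole word if `t` exceeds its length. -/
def pre {A : Type u} (w : List A) (t : ℕ) : List A := w.take t

/-- `α[t]`: the suffix of length `t` of a word, the whole word if `t` exceeds its length. -/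
def suf {A : Type u} (w : List A) (t : ℕ) : List A := w.drop (w.length - t)

/-- `con(α)`: the set of letters occurring in a word. -/
def con {A : Type u} (w : List A) : Set A := {a | a ∈ w}

/-- A subset `L` of `A⁺` viewed as a language over `A`. -/
def toLanguage {A : Type u} (L : Set (FreeSemigroup A)) : Language A :=
  {w | ∃ x ∈ L, word x = w}

/-! ### Padded pairs of words -/

/-- The alphabet `A(2,$) = (A ∪ {$}) × (A ∪ {$}) - {($,$)}`, with `none` in the role of `$`. -/
abbrev PadAlphabet (A : Type u) : Type u :=
  {p : Option A × Option A // p ≠ (none, none)}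

/-- Right padding `(α, β) ↦ (α, β)δ^R`: the shorter word is completed by `$` on the right. -/
def padR {A : Type u} : List A → List A → List (PadAlphabet A)
  | [], [] => []
  | a :: x, [] => ⟨(some a, none), by simp⟩ :: padR x []
  | [], b :: y => ⟨(none, some b), by simp⟩ :: padR [] y
  | a :: x, b :: y => ⟨(some a, some b), by simp⟩ :: padR x y

/-- Left padding `(α, β) ↦ (α, β)δ^L`: the shorter word is completed by `$` on the left. -/
def padL {A : Type u} (x y : List A) : List (PadAlphabet A) :=
  (padR x.reverse y.reverse).reverse

/-- The language `{(α, β)δ^R | (α, β) ∈ U}` over `A(2,$)`. -/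
def padRLanguage {A : Type u} (U : FreeSemigroup A → FreeSemigroup A → Prop) :
    Language (PadAlphabet A) :=
  {z | ∃ α β, U α β ∧ z = padR (word α) (word β)}

/-- The language `{(α, β)δ^L | (α, β) ∈ U}` over `A(2,$)`. -/
def padLLanguage {A : Type u} (U : FreeSemigroup A → FreeSemigroup A → Prop) :
    Language (PadAlphabet A) :=
  {z | ∃ α β, U α β ∧ z = padL (word α) (word β)}

/-! ### Automatic structures -/

section Automatic

variable {A S : Type u} [Semigroup S]

/-- `α, β ∈ L` and `aα = β` in `S`, for `a ∈ A ∪ {ε}` (`none` stands for `ε`). -/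
def LeftMulRel (φ : FreeSemigroup A →ₙ* S) (L : Set (FreeSemigroup A)) :
    Option A → FreeSemigroup A → FreeSemigroup A → Prop
  | none, α, β => α ∈ L ∧ β ∈ L ∧ φ α = φ β
  | some a, α, β => α ∈ L ∧ β ∈ L ∧ φ (FreeSemigroup.of a * α) = φ β

/-- `α, β ∈ L` and `αa = β` in `S`, for `a ∈ A ∪ {ε}` (`none` stands for `ε`). -/
def RightMulRel (φ : FreeSemigroup A →ₙ* S) (L : Set (FreeSemigroup A)) :
    Option A → FreeSemigroup A → FreeSemigroup A → Prop
  | none, α, β => α ∈ L ∧ β ∈ L ∧ φ α = φ β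
  | some a, α, β => α ∈ L ∧ β ∈ L ∧ φ (α * FreeSemigroup.of a) = φ β

/-- `α ∈ L`, `β` is a (nonempty) prefix of a word of `L`, and `α = β` in `S`. -/
def PrefixRel (φ : FreeSemigroup A →ₙ* S) (L : Set (FreeSemigroup A))
    (α β : FreeSemigroup A) : Prop :=
  α ∈ L ∧ (∃ γ ∈ L, word β <+: word γ) ∧ φ α = φ β

/-- The alphabet `A` is finite, `L` is a regular language of nonempty words over `A`, and the
homomorphism `φ : A⁺ → S` satisfies `φ(L) = S`. -/
structure IsRegularRepresentation (φ : FreeSemigroup A →ₙ* S)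
    (L : Set (FreeSemigroup A)) : Prop where
  finite : Finite A
  regular : (toLanguage L).IsRegular
  surjOn : φ '' L = Set.univ

/-- `(A, L)` is a (right-right) automatic structure for `S`. -/
structure IsAutomaticStructure (φ : FreeSemigroup A →ₙ* S)
    (L : Set (FreeSemigroup A)) : Prop extends IsRegularRepresentation φ L where
  right_right : ∀ a : Option A, (padRLanguage (RightMulRel φ L a)).IsRegular

/-- `(A, L)` is a biautomatic structure for `S`. -/
structure IsBiautomaticStructure (φ : FreeSemigroup A →ₙ* S)
    (L : Set (FreeSemigroup A)) : Prop extends IsRegularRepresentation φ L where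
  left_left : ∀ a : Option A, (padLLanguage (LeftMulRel φ L a)).IsRegular
  left_right : ∀ a : Option A, (padLLanguage (RightMulRel φ L a)).IsRegular
  right_left : ∀ a : Option A, (padRLanguage (LeftMulRel φ L a)).IsRegular
  right_right : ∀ a : Option A, (padRLanguage (RightMulRel φ L a)).IsRegular

/-- `(A, L)` is a prefix-automatic structure for `S`. -/
structure IsPrefixAutomaticStructure (φ : FreeSemigroup A →ₙ* S)
    (L : Set (FreeSemigroup A)) : Prop extends IsAutomaticStructure φ L where
  pref : (padRLanguage (PrefixRel φ L)).IsRegular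

end Automatic

/-- `S` is a biautomatic semigroup. -/
def IsBiautomatic (S : Type u) [Semigroup S] : Prop :=
  ∃ (A : Type u) (φ : FreeSemigroup A →ₙ* S) (L : Set (FreeSemigroup A)),
    IsBiautomaticStructure φ L

/-- `S` is a prefix-automatic semigroup. -/
def IsPrefixAutomatic (S : Type u) [Semigroup S] : Prop :=
  ∃ (A : Type u) (φ : FreeSemigroup A →ₙ* S) (L : Set (FreeSemigroup A)),
    IsPrefixAutomaticStructure φ L

/-! ### One-relator semigroups -/

/-- The congruence on `A⁺` generated by the single pair `(x, y)`. -/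
def relatorCon {A : Type u} (x y : FreeSemigroup A) : Con (FreeSemigroup A) :=
  conGen fun p q => p = x ∧ q = y

/-- The one-relator semigroup `sgp⁺⟨A | x = y⟩`. -/
abbrev OneRelatorSemigroup {A : Type u} (x y : FreeSemigroup A) : Type u :=
  (relatorCon x y).Quotient

/-! ### Gröbner-Shirshov bases in the free associative algebra `F⟨A⟩` -/

section GroebnerShirshov

open MonoidAlgebra

/-- The deg-lex ordering on `A*`. -/
def WordDegLex {A : Type u} [LinearOrder A] (x y : FreeMonoid A) : Prop :=
  List.Shortlex (· < ·) x.toList y.toList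

variable {A F : Type*} [Field F]

/-- `w` is the leading word of the polynomial `f` with respect to the ordering `lt` on `A*`. -/
def IsLeadingWord (lt : FreeMonoid A → FreeMonoid A → Prop)
    (f : MonoidAlgebra F (FreeMonoid A)) (w : FreeMonoid A) : Prop :=
  w ∈ f.coeff.support ∧ ∀ x ∈ f.coeff.support, x ≠ w → lt x w

/-- `f` is nonzero and the coefficient of its leading word is `1`. -/
def IsMonic (lt : FreeMonoid A → FreeMonoid A → Prop)
    (f : MonoidAlgebra F (FreeMonoid A)) : Prop :=
  ∃ w, IsLeadingWord lt f w ∧ f.coeff w = 1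

/-- `p` is trivial modulo `(R, w)`: it is a linear combination of polynomials `a s b` with
`s ∈ R` and `a, b ∈ A*` such that `a s̄ b < w`, where `s̄` is the leading word of `s`. -/
def IsTrivialModulo (lt : FreeMonoid A → FreeMonoid A → Prop)
    (R : Set (MonoidAlgebra F (FreeMonoid A))) (w : FreeMonoid A)
    (p : MonoidAlgebra F (FreeMonoid A)) : Prop :=
  p ∈ Submodule.span F {q | ∃ s ∈ R, ∃ s' a b : FreeMonoid A,
    IsLeadingWord lt s s' ∧ lt (a * s' * b) w ∧
      q = of F (FreeMonoid A) a * s * of F (FreeMonoid A) b}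

/-- `R` is a Gröbner-Shirshov basis with respect to the ordering `lt`: it consists of monic
polynomials, and all intersection and inclusion compositions of its elements are trivial. -/
structure IsGroebnerShirshovBasis (lt : FreeMonoid A → FreeMonoid A → Prop)
    (R : Set (MonoidAlgebra F (FreeMonoid A))) : Prop where
  monic : ∀ f ∈ R, IsMonic lt f
  intersection : ∀ f ∈ R, ∀ g ∈ R, ∀ f' g' a b w : FreeMonoid A,
    IsLeadingWord lt f f' → IsLeadingWord lt g g' →
    w = f' * b → w = a * g' → w.length < f'.length + g'.length →
    IsTrivialModulo lt R w (f * of F (FreeMonoid A) b - of F (FreeMonoid A) a * g)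
  inclusion : ∀ f ∈ R, ∀ g ∈ R, ∀ f' g' a b : FreeMonoid A,
    IsLeadingWord lt f f' → IsLeadingWord lt g g' → f' = a * g' * b →
    IsTrivialModulo lt R f' (f - of F (FreeMonoid A) a * g * of F (FreeMonoid A) b)

variable (F) in
/-- The relation `x = y` of words, viewed as the polynomial `x - y` in `F⟨A⟩`. -/
noncomputable def relatorPoly (x y : FreeSemigroup A) : MonoidAlgebra F (FreeMonoid A) :=
  of F (FreeMonoid A) (FreeMonoid.ofList (word x)) -
    of F (FreeMonoid A) (FreeMonoid.ofList (word y))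

end GroebnerShirshov

end OneRelator

namespace OneRelator

/-! ### Closure properties of regular languages, including bounded delays between the components of
a pair. -/

section Regular

variable {α β : Type*}

/-! The rule `u → v` preserves length and lowers the deg-lex order, so it terminates, and the
Gröbner–Shirshov hypothesis makes normal forms, the words without factor `u`, unique (`irr_unique`).
The non-empty normal forms serve as the regular language of representatives. Equality in the
semigroup is then equality of words, also for prefixes, since factors of normal forms are normal.

Let `α` be normal and `a` a letter. If `αa` is not normal, it ends in `u`, which is replaced by `v`.
Each of the five conditions yields `RewritesLeftwards` for the rule and for its reversal, and this
ensures that no occurrence of `u` ever starts inside the newly written `v`. The next occurrence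
therefore starts to the left of `v` and ends inside it: `u = Uy`, `v = yV`, and `Uv = uV` becomes
`vV`. Iterating, `γU₁⋯Uₘu` becomes `γvV₁⋯Vₘ` (`exists_leftward_rewriting`, `conv_iff_explicitMul`).

There are finitely many pairs `(U, V)`, and `|U| = |V|`, so the pairs `(U₁⋯Uₘ, V₁⋯Vₘ)` read letter
by letter form the star of a finite language. The offset caused by `u` and `v` is a bounded delay,
which preserves regularity (`delay_isRegular`). As a product with a letter is exactly one letter
longer, either padding inserts a single `$`, at the end or at the front. Left multiplication follows
by reversing all words. -/

/-- Myhill–Nerode, in a form where it suffices to encode each left quotient by an element of a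
finite set. -/
theorem isRegular_of_finite_range {ι : Type*} {L : Language α} (s : Set ι) (hs : s.Finite)
    (f : ι → Language α) (h : ∀ x, ∃ i ∈ s, L.leftQuotient x = f i) : L.IsRegular := by
  refine Language.IsRegular.of_finite_range_leftQuotient ((hs.image f).subset ?_)
  rintro _ ⟨x, rfl⟩
  obtain ⟨i, hi, e⟩ := h x
  exact ⟨i, hi, e.symm⟩

theorem isRegular_of_mem_iff {L M : Language α} (h : M.IsRegular) (e : ∀ w, w ∈ L ↔ w ∈ M) :
    L.IsRegular :=
  Language.ext e ▸ h

/-- The union of a set of languages. -/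
def unionLanguage (S : Set (Language α)) : Language α := {x | ∃ l ∈ S, x ∈ l}

/-- A word of `L * M` starting with `x` is cut either after `x` or within `x`. Hence the quotient by
`x` depends only on one quotient of `L` and on the set of quotients of `M` by those `y` with `x =
ay`, `a ∈ L`. -/
theorem isRegular_mul {L M : Language α} (hL : L.IsRegular) (hM : M.IsRegular) :
    (L * M).IsRegular := by
  refine isRegular_of_finite_range
    ((Set.range L.leftQuotient) ×ˢ (𝒫 (Set.range M.leftQuotient)))
    (hL.finite_range_leftQuotient.prod hM.finite_range_leftQuotient.powerset)
    (fun p => p.1 * M + unionLanguage p.2) fun x => ?_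
  refine ⟨(L.leftQuotient x, {Q | ∃ a ∈ L, ∃ y, a ++ y = x ∧ Q = M.leftQuotient y}), ?_, ?_⟩
  · refine ⟨⟨x, rfl⟩, ?_⟩
    rintro _ ⟨a, _, y, _, rfl⟩
    exact ⟨y, rfl⟩
  · ext y
    rw [Language.mem_leftQuotient, Language.mem_mul, Language.mem_add, Language.mem_mul]
    constructor
    · rintro ⟨a, ha, b, hb, e⟩
      rcases List.append_eq_append_iff.1 e with ⟨c, rfl, rfl⟩ | ⟨c, rfl, rfl⟩
      · exact Or.inr ⟨M.leftQuotient c, ⟨a, ha, c, rfl, rfl⟩, hb⟩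
      · exact Or.inl ⟨c, ha, b, hb, rfl⟩
    · rintro (⟨a, ha, b, hb, rfl⟩ | ⟨_, ⟨a, ha, c, rfl, rfl⟩, hy⟩)
      · exact ⟨x ++ a, ha, b, hb, by simp⟩
      · exact ⟨a, ha, c ++ y, hy, by simp⟩

open scoped Computability in
-- The end of `x` falls inside a block or between two blocks, so the quotient by `x` is governed by
-- the quotients of `K` by those `y` with `x = ay`, `a ∈ K∗`. The Boolean records whether `x ∈ K∗`,
-- which decides whether the empty word belongs to the quotient when no further block follows.
theorem isRegular_kstar {K : Language α} (hK : K.IsRegular) : K∗.IsRegular := by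
  classical
  refine isRegular_of_finite_range
    ((𝒫 (Set.range K.leftQuotient)) ×ˢ (Set.univ : Set Bool))
    (hK.finite_range_leftQuotient.powerset.prod Set.finite_univ)
    (fun p => unionLanguage p.1 * K∗ +
      if p.2 then 1 else 0) fun x => ?_
  refine ⟨({Q | ∃ a ∈ K∗, ∃ y, a ++ y = x ∧ Q = K.leftQuotient y}, decide (x ∈ K∗)), ?_, ?_⟩
  · refine ⟨?_, trivial⟩
    rintro _ ⟨a, _, y, _, rfl⟩
    exact ⟨y, rfl⟩
  · ext y
    rw [Language.mem_leftQuotient, Language.mem_add, Language.mem_mul]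
    constructor
    · intro h
      obtain ⟨l, e, hl⟩ := Language.mem_kstar.1 h
      rcases List.flatten_eq_append_iff.1 e.symm with ⟨as, bs, rfl, rfl, rfl⟩ |
        ⟨as, bs, c, cs, ds, rfl, rfl, rfl⟩
      · have hx : as.flatten ∈ K∗ := Language.join_mem_kstar fun y hy => hl y (by simp [hy])
        rcases bs with _ | ⟨b, bs⟩
        · right
          simp [hx]
        · left
          refine ⟨b, ⟨K.leftQuotient [], ⟨_, hx, [], by simp, rfl⟩, hl b (by simp)⟩, bs.flatten,
            Language.join_mem_kstar fun y hy => hl y (by simp [hy]), by simp⟩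
      · left
        refine ⟨c :: cs, ⟨K.leftQuotient bs, ⟨as.flatten,
          Language.join_mem_kstar fun y hy => hl y (by simp [hy]), bs, rfl, rfl⟩,
          hl (bs ++ c :: cs) (by simp)⟩, ds.flatten,
          Language.join_mem_kstar fun y hy => hl y (by simp [hy]), by simp⟩
    · rintro (⟨b, ⟨_, ⟨a, ha, c, rfl, rfl⟩, hb⟩, d, hd, rfl⟩ | hy)
      · obtain ⟨l, rfl, hl⟩ := Language.mem_kstar.1 ha
        obtain ⟨m, rfl, hm⟩ := Language.mem_kstar.1 hd
        refine Language.mem_kstar.2 ⟨l ++ (c ++ b) :: m, by simp, ?_⟩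
        intro z hz
        simp only [List.mem_append, List.mem_cons] at hz
        rcases hz with hz | rfl | hz
        exacts [hl z hz, hb, hm z hz]
      · by_cases hx : x ∈ K∗
        · simp only [hx, decide_true, if_true, Language.mem_one] at hy
          simpa [hy] using hx
        · simp [hx] at hy

theorem isRegular_zero : (0 : Language α).IsRegular :=
  isRegular_of_finite_range {()} (Set.finite_singleton _) (fun _ => 0) fun _ => ⟨(), rfl, rfl⟩

theorem isRegular_singleton (w : List α) : ({w} : Language α).IsRegular := by
  refine isRegular_of_finite_range (Set.univ ×ˢ Set.Iic w.length)
    (Set.finite_univ.prod (Set.finite_Iic _))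
    (fun p : Bool × ℕ => if p.1 then {w.drop p.2} else 0) fun x => ?_
  by_cases h : x <+: w
  · obtain ⟨y, rfl⟩ := h
    refine ⟨(true, x.length), by simp, ?_⟩
    ext z
    simp only [Language.mem_leftQuotient, if_true, List.drop_left]
    exact List.append_right_inj x
  · refine ⟨(false, 0), by simp, ?_⟩
    ext z
    simp only [Language.mem_leftQuotient, Bool.false_eq_true, if_false, Language.notMem_zero,
      iff_false]
    rintro rfl
    exact h ⟨z, rfl⟩

theorem isRegular_finite {s : Set (List α)} (hs : s.Finite) :
    Language.IsRegular (s : Language α) := by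
  induction s, hs using Set.Finite.induction_on with
  | empty => exact isRegular_zero
  | insert _ _ ih =>
    rename_i a s _ _
    exact (isRegular_singleton a).add ih

theorem isRegular_top : Language.IsRegular ((Set.univ : Set (List α)) : Language α) := by
  have e : ((Set.univ : Set (List α)) : Language α) = (0 : Language α)ᶜ :=
    Set.compl_empty.symm
  exact e ▸ isRegular_zero.compl

/-- The automaton stands still on erased letters. Applied to a projection of padded pairs, this
imposes a regular condition on one component with its `$` removed. -/
theorem isRegular_filterMap {L : Language β} (hL : L.IsRegular) (f : α → Option β) :
    Language.IsRegular ({w | w.filterMap f ∈ L} : Language α) := by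
  obtain ⟨σ, _, M, rfl⟩ := hL
  refine ⟨σ, inferInstance, ⟨fun s a => (f a).elim s (M.step s), M.start, M.accept⟩, ?_⟩
  have key : ∀ (w : List α) (s : σ),
      w.foldl (fun s a => (f a).elim s (M.step s)) s = M.evalFrom s (w.filterMap f) := by
    intro w
    induction w with
    | nil => intro s; rfl
    | cons a w ih =>
      intro s
      cases h : f a with
      | none => simp [h, ih]
      | some b => simp [h, ih, DFA.evalFrom]
  ext w
  change w.foldl _ M.start ∈ M.accept ↔ M.evalFrom M.start (w.filterMap f) ∈ M.accept
  rw [key]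

theorem isRegular_map_preimage {L : Language β} (hL : L.IsRegular) (f : α → β) :
    Language.IsRegular ({w | w.map f ∈ L} : Language α) := by
  have := isRegular_filterMap hL (fun a => some (f a))
  simpa using this

/-- The pairs `(PC, DQ)` with `(P, Q)` in `K`, all pairs being written letter by letter. -/
def delay (K : Language (α × β)) (C : List α) (D : List β) : Language (α × β) :=
  {w | ∃ P Q, P.length = Q.length ∧ List.zip P Q ∈ K ∧ w = List.zip (P ++ C) (D ++ Q)}

/-- A delay by several letters is a succession of delays by one letter, so only the latter needs an
automaton. -/
theorem delay_append {K : Language (α × β)} (c : α) (d : β) (C : List α) (D : List β) :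
    delay K (c :: C) (D ++ [d]) = delay (delay K [c] [d]) C D := by
  ext w
  constructor
  · rintro ⟨P, Q, h, hK, rfl⟩
    exact ⟨P ++ [c], d :: Q, by simp [h], ⟨P, Q, h, hK, rfl⟩, by simp⟩
  · rintro ⟨P, Q, h, ⟨P', Q', h', hK, e⟩, rfl⟩
    have h1 := congrArg (List.map Prod.fst) e
    have h2 := congrArg (List.map Prod.snd) e
    rw [List.map_fst_zip (by omega), List.map_fst_zip (by simp [h'])] at h1
    rw [List.map_snd_zip (by omega), List.map_snd_zip (by simp [h'])] at h2
    subst h1 h2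
    exact ⟨P', Q', h', hK, by simp⟩

/-- The automaton holds back the latest first component until its partner is read one position
later. Finiteness of `α` bounds the memory needed for this. -/
theorem delay_singleton_isRegular [Finite α] {K : Language (α × β)} (hK : K.IsRegular)
    (c : α) (d : β) : (delay K [c] [d]).IsRegular := by
  classical
  obtain ⟨σ, _, M, rfl⟩ := hK
  have := Fintype.ofFinite α
  -- `none` is the initial state, `some none` the dead state (the first second component was not
  -- `d`), and `some (some (p, s))` holds the unmatched letter `p`. Acceptance requires the letter
  -- held at the end to be `c`.
  let step : Option (Option (α × σ)) → α × β → Option (Option (α × σ)) := fun s x =>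
    match s with
    | none => if x.2 = d then some (some (x.1, M.start)) else some none
    | some none => some none
    | some (some (p, s)) => some (some (x.1, M.step s (p, x.2)))
  have dead : ∀ w : List (α × β), w.foldl step (some none) = some none := by
    intro w
    induction w with
    | nil => rfl
    | cons x w ih => exact ih
  have key : ∀ (w : List (α × β)) (p : α) (s : σ),
      (∃ t ∈ M.accept, w.foldl step (some (some (p, s))) = some (some (c, t))) ↔
      ∃ P Q, P.length = Q.length ∧ M.evalFrom s (List.zip P Q) ∈ M.accept ∧
        p :: w.map Prod.fst = P ++ [c] ∧ w.map Prod.snd = Q := by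
    intro w
    induction w with
    | nil =>
      intro p s
      constructor
      · rintro ⟨t, ht, e⟩
        simp only [List.foldl_nil, Option.some.injEq, Prod.mk.injEq] at e
        obtain ⟨rfl, rfl⟩ := e
        exact ⟨[], [], rfl, ht, rfl, rfl⟩
      · rintro ⟨P, Q, hl, h, e1, e2⟩
        simp only [List.map_nil] at e2
        subst e2
        simp only [List.length_nil, List.length_eq_zero_iff] at hl
        subst hl
        simp only [List.map_nil, List.nil_append, List.cons.injEq, and_true] at e1
        subst e1
        exact ⟨s, h, rfl⟩
    | cons x w ih =>
      intro p s
      rw [List.foldl_cons]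
      change (∃ t ∈ M.accept, w.foldl step (some (some (x.1, M.step s (p, x.2)))) = _) ↔ _
      rw [ih]
      constructor
      · rintro ⟨P, Q, hl, h, e1, e2⟩
        exact ⟨p :: P, x.2 :: Q, by simp [hl], h, by simp [e1], by simp [e2]⟩
      · rintro ⟨P, Q, hl, h, e1, e2⟩
        rcases Q with _ | ⟨q, Q⟩
        · simp at e2
        rcases P with _ | ⟨p', P⟩
        · simp at hl
        simp only [List.map_cons, List.cons_append, List.cons.injEq] at e1 e2
        obtain ⟨rfl, e1⟩ := e1
        obtain ⟨rfl, e2⟩ := e2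
        exact ⟨P, Q, by simpa using hl, h, e1, e2⟩
  refine Language.isRegular_iff.2 ⟨Option (Option (α × σ)), inferInstance,
    ⟨step, none, {s | ∃ t ∈ M.accept, s = some (some (c, t))}⟩, ?_⟩
  ext w
  change (∃ t ∈ M.accept, w.foldl step none = some (some (c, t))) ↔ _
  rcases w with _ | ⟨x, w⟩
  · constructor
    · rintro ⟨t, _, e⟩
      simp at e
    · rintro ⟨P, Q, _, _, e⟩
      have := congrArg List.length e
      simp at this
  · rw [List.foldl_cons]
    by_cases hx : x.2 = d
    · have : step none x = some (some (x.1, M.start)) := by simp [step, hx]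
      rw [this, key]
      constructor
      · rintro ⟨P, Q, hl, h, e1, e2⟩
        refine ⟨P, Q, hl, h, ?_⟩
        rw [← e1, ← e2, ← hx]
        exact (List.zip_of_prod (l := x.1 :: w.map Prod.fst) (l' := x.2 :: w.map Prod.snd)
          (by simp) (by simp))
      · rintro ⟨P, Q, hl, h, e⟩
        have h1 := congrArg (List.map Prod.fst) e
        have h2 := congrArg (List.map Prod.snd) e
        rw [List.map_fst_zip (by simp [hl])] at h1
        rw [List.map_snd_zip (by simp [hl])] at h2
        simp only [List.map_cons, List.cons_append, List.nil_append, List.cons.injEq] at h1 h2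
        exact ⟨P, Q, hl, h, h1, h2.2⟩
    · have : step none x = some none := by simp [step, hx]
      rw [this, dead]
      constructor
      · rintro ⟨t, _, e⟩
        simp at e
      · rintro ⟨P, Q, hl, h, e⟩
        have h2 := congrArg (List.map Prod.snd) e
        rw [List.map_snd_zip (by simp [hl])] at h2
        simp only [List.map_cons, List.cons_append, List.nil_append, List.cons.injEq] at h2
        exact absurd h2.1 hx

theorem delay_isRegular [Finite α] {K : Language (α × β)} (hK : K.IsRegular)
    (C : List α) (D : List β) (h : C.length = D.length) : (delay K C D).IsRegular := by
  induction C generalizing K D with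
  | nil =>
    simp only [List.length_nil] at h
    rw [List.eq_nil_of_length_eq_zero h.symm]
    convert hK using 1
    ext w
    constructor
    · rintro ⟨P, Q, hl, h, rfl⟩
      simpa using h
    · intro hw
      exact ⟨w.map Prod.fst, w.map Prod.snd, by simp, by
        rwa [← List.zip_of_prod (l := w.map Prod.fst) (l' := w.map Prod.snd) rfl rfl],
        by simpa using List.zip_of_prod (l := w.map Prod.fst) (l' := w.map Prod.snd) rfl rfl⟩
  | cons c C ih =>
    rcases List.eq_nil_or_concat' D with rfl | ⟨D, d, rfl⟩
    · simp at h
    · rw [delay_append]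
      exact ih (delay_singleton_isRegular hK c d) D (by simpa using h)

end Regular
end OneRelator
namespace OneRelator

/-! ### Rewriting by one rule: uniqueness of normal forms and the shape of products with a letter.
-/

section Rewriting

variable {A : Type*}

/-- One application of the rule `u → v` inside a word. -/
def Step (u v x y : List A) : Prop := ∃ c d, x = c ++ u ++ d ∧ y = c ++ v ++ d

/-- The congruence on words generated by `u = v`. -/
def Conv (u v : List A) : List A → List A → Prop := Relation.EqvGen (Step u v)

/-- The words without factor `u`. -/
def Irr (u x : List A) : Prop := ¬ u <:+: x

theorem eqvGen_map {α β : Type*} {r : α → α → Prop} {s : β → β → Prop} (f : α → β)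
    (h : ∀ x y, r x y → Relation.EqvGen s (f x) (f y)) {x y : α} (e : Relation.EqvGen r x y) :
    Relation.EqvGen s (f x) (f y) := by
  induction e with
  | rel x y h' => exact h _ _ h'
  | refl x => exact .refl _
  | symm x y _ ih => exact .symm _ _ ih
  | trans x y z _ _ h1 h2 => exact .trans _ _ _ h1 h2

theorem Conv.append {u v x y : List A} (h : Conv u v x y) (c d : List A) :
    Conv u v (c ++ x ++ d) (c ++ y ++ d) := by
  refine eqvGen_map (fun x => c ++ x ++ d) ?_ h
  rintro _ _ ⟨a, b, rfl, rfl⟩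
  exact .rel _ _ ⟨c ++ a, b ++ d, by simp, by simp⟩

theorem Conv.reverse {u v x y : List A} (h : Conv u v x y) :
    Conv u.reverse v.reverse x.reverse y.reverse := by
  refine eqvGen_map List.reverse ?_ h
  rintro _ _ ⟨a, b, rfl, rfl⟩
  exact .rel _ _ ⟨b.reverse, a.reverse, by simp, by simp⟩

theorem conv_reverse_iff {u v x y : List A} :
    Conv u.reverse v.reverse x.reverse y.reverse ↔ Conv u v x y :=
  ⟨fun h => by simpa using h.reverse, Conv.reverse⟩

theorem irr_reverse_iff {u x : List A} : Irr u.reverse x.reverse ↔ Irr u x :=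
  not_congr List.reverse_infix

theorem Irr.of_infix {u x y : List A} (h : Irr u y) (hx : x <:+: y) : Irr u x :=
  fun h' => h (h'.trans hx)

theorem Conv.length_eq {u v x y : List A} (huv : u.length = v.length) (h : Conv u v x y) :
    x.length = y.length := by
  induction h with
  | rel x y h =>
    obtain ⟨c, d, rfl, rfl⟩ := h
    simp [huv]
  | refl x => rfl
  | symm x y _ ih => exact ih.symm
  | trans x y z _ _ h1 h2 => exact h1.trans h2

/-- Equal lengths are essential: a proper prefix is lexicographically smaller, but this may fail
after appending. -/
theorem lex_append_right {r : A → A → Prop} {x y : List A} (h : List.Lex r x y)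
    (hl : x.length = y.length) (d : List A) : List.Lex r (x ++ d) (y ++ d) := by
  induction h with
  | nil => simp at hl
  | cons _ ih => exact .cons (ih (by simpa using hl))
  | rel h => exact .rel h

theorem shortlex_append_append {r : A → A → Prop} {x y : List A} (h : List.Shortlex r x y)
    (c d : List A) : List.Shortlex r (c ++ x ++ d) (c ++ y ++ d) := by
  rw [List.append_assoc, List.append_assoc]
  refine List.Shortlex.append_left ?_ c
  rcases List.shortlex_def.1 h with h | ⟨hl, h⟩
  · exact .of_length_lt (by simpa using h)
  · exact .of_lex (by simp [hl]) (lex_append_right h hl d)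

/-- Every overlap `uq = pu` of `u` with itself is resolved below `uq`. -/
def CriticalPairsResolve (r : A → A → Prop) (u v : List A) : Prop :=
  ∀ p q, u ++ q = p ++ u → q.length < u.length →
    Relation.EqvGen (fun x y => ∃ c d, x = c ++ u ++ d ∧ y = c ++ v ++ d ∧
      List.Shortlex r x (u ++ q)) (v ++ q) (p ++ v)

/-- In every reducible word one occurrence of `u` is chosen and rewritten, and well-founded
recursion does the rest. That the outcome does not depend on the choice is not claimed here. -/
theorem exists_rewriting_normal_form {r : A → A → Prop} (hr : WellFounded r) {u v : List A}
    (huv : List.Shortlex r v u) :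
    ∃ nf : List A → List A, (∀ x, Irr u x → nf x = x) ∧ ∀ x, ¬ Irr u x →
      ∃ c d, x = c ++ u ++ d ∧ nf x = nf (c ++ v ++ d) := by
  classical
  have hsplit : ∀ x : List A, ¬ Irr u x → ∃ p : List A × List A, x = p.1 ++ u ++ p.2 := by
    intro x h
    obtain ⟨c, d, e⟩ := not_not.1 h
    exact ⟨(c, d), e.symm⟩
  choose! f hf using hsplit
  let F : (x : List A) → ((y : List A) → List.Shortlex r y x → List A) → List A :=
    fun x rec => if h : Irr u x then x else rec ((f x).1 ++ v ++ (f x).2) (by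
      conv_rhs => rw [hf x h]
      exact shortlex_append_append huv _ _)
  refine ⟨(List.Shortlex.wf hr).fix F, fun x hx => ?_, fun x hx => ⟨(f x).1, (f x).2, hf x hx, ?_⟩⟩
  · rw [WellFounded.fix_eq]
    simp [F, hx]
  · rw [WellFounded.fix_eq]
    exact dif_neg hx

/-- The diamond lemma. By induction along the shortlex order, `nf` is unchanged by every single
rewriting, not only by the chosen one. It is then constant on congruence classes and fixes
irreducible words. -/
theorem irr_unique {r : A → A → Prop} (hr : WellFounded r) {u v : List A}
    (huv : List.Shortlex r v u) (hcp : CriticalPairsResolve r u v) {x y : List A}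
    (hx : Irr u x) (hy : Irr u y) (h : Conv u v x y) : x = y := by
  obtain ⟨nf, h1, h2⟩ := exists_rewriting_normal_form hr huv
  have key : ∀ x c d, x = c ++ u ++ d → nf x = nf (c ++ v ++ d) := by
    intro x
    induction x using (List.Shortlex.wf hr).induction with
    | _ x ih =>
    have ordered : ∀ c d c' d', x = c ++ u ++ d → x = c' ++ u ++ d' → c.length ≤ c'.length →
        nf (c ++ v ++ d) = nf (c' ++ v ++ d') := by
      intro c d c' d' e e' hl
      have e0 : c ++ (u ++ d) = c' ++ (u ++ d') := by simpa using e.symm.trans e'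
      obtain ⟨p, rfl, e1⟩ : ∃ p, c' = c ++ p ∧ u ++ d = p ++ (u ++ d') := by
        rcases List.append_eq_append_iff.1 e0 with ⟨p, rfl, e1⟩ | ⟨p, rfl, e1⟩
        · exact ⟨p, rfl, e1⟩
        · have : p = [] := by
            rw [← List.length_eq_zero_iff]
            simp only [List.length_append] at hl
            omega
          subst this
          exact ⟨[], by simp, by simpa using e1.symm⟩
      -- Disjoint occurrences commute: rewriting the other one leads both sides to the same word,
      -- and both intermediate words are smaller than `x`.
      by_cases hp : u.length ≤ p.length
      · obtain ⟨m, rfl, rfl⟩ : ∃ m, p = u ++ m ∧ d = m ++ (u ++ d') := by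
          rcases List.append_eq_append_iff.1 e1 with ⟨m, rfl, e2⟩ | ⟨m, rfl, e2⟩
          · exact ⟨m, rfl, e2⟩
          · have : m = [] := by
              rw [← List.length_eq_zero_iff]
              simp only [List.length_append] at hp
              omega
            subst this
            exact ⟨[], by simp, by simpa using e2.symm⟩
        have t1 : nf (c ++ v ++ (m ++ (u ++ d'))) = nf (c ++ v ++ m ++ v ++ d') := by
          refine ih _ ?_ _ _ (by simp)
          rw [e]
          exact shortlex_append_append huv _ _
        have t2 : nf (c ++ (u ++ m) ++ v ++ d') = nf (c ++ v ++ (m ++ v ++ d')) := by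
          refine ih _ ?_ _ _ (by simp)
          rw [e']
          exact shortlex_append_append huv _ _
        rw [t1, t2]
        simp
      · obtain ⟨q, e2, rfl⟩ : ∃ q, u ++ q = p ++ u ∧ d = q ++ d' := by
          have e1' : u ++ d = (p ++ u) ++ d' := by simpa using e1
          rcases List.append_eq_append_iff.1 e1' with ⟨m, h3, h4⟩ | ⟨m, h3, h4⟩
          · exact ⟨m, h3.symm, h4⟩
          · have : m = [] := by
              rw [← List.length_eq_zero_iff]
              have := congrArg List.length h3
              simp only [List.length_append] at this
              omega
            subst this
            exact ⟨[], by simpa using h3, by simpa using h4.symm⟩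
        have hq : q.length < u.length := by
          have := congrArg List.length e2
          simp only [List.length_append] at this
          omega
        have t := hcp p q e2 hq
        have hx' : x = c ++ (u ++ q) ++ d' := by simpa using e
        -- Rewritings below `uq`, placed in the context `c`, `d'`, start from words smaller than
        -- `x`, so the induction hypothesis applies to each link of the chain.
        have step : ∀ a b, Relation.EqvGen (fun x y => ∃ c d, x = c ++ u ++ d ∧
            y = c ++ v ++ d ∧ List.Shortlex r x (u ++ q)) a b →
            nf (c ++ a ++ d') = nf (c ++ b ++ d') := by
          intro a b hab
          induction hab with
          | rel _ _ h' =>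
            obtain ⟨c1, d1, rfl, rfl, hlt⟩ := h'
            have := ih _ (by rw [hx']; exact shortlex_append_append hlt c d') (c ++ c1) (d1 ++ d')
              (by simp)
            simpa using this
          | refl => rfl
          | symm _ _ _ ih' => exact ih'.symm
          | trans _ _ _ _ _ i1 i2 => exact i1.trans i2
        have := step _ _ t
        simpa using this
    have all : ∀ c d c' d', x = c ++ u ++ d → x = c' ++ u ++ d' →
        nf (c ++ v ++ d) = nf (c' ++ v ++ d') := by
      intro c d c' d' e e'
      rcases le_total c.length c'.length with hl | hl
      · exact ordered c d c' d' e e' hl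
      · exact (ordered c' d' c d e' e hl).symm
    intro c d e
    obtain ⟨c', d', e', hn⟩ := h2 x (fun h => h ⟨c, d, e.symm⟩)
    rw [hn]
    exact all _ _ _ _ e' e
  have main : ∀ a b, Conv u v a b → nf a = nf b := by
    intro a b hab
    induction hab with
    | rel _ _ h' =>
      obtain ⟨c, d, rfl, rfl⟩ := h'
      exact key _ c d rfl
    | refl => rfl
    | symm _ _ _ ih' => exact ih'.symm
    | trans _ _ _ _ _ i1 i2 => exact i1.trans i2
  rw [← h1 x hx, ← h1 y hy, main x y h]

theorem exists_irr {r : A → A → Prop} (hr : WellFounded r) {u v : List A}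
    (huv : List.Shortlex r v u) (x : List A) : ∃ y, Irr u y ∧ Conv u v x y := by
  induction x using (List.Shortlex.wf hr).induction with
  | _ x ih =>
  by_cases hx : Irr u x
  · exact ⟨x, hx, .refl _⟩
  · obtain ⟨c, d, rfl⟩ := not_not.1 hx
    obtain ⟨y, hy, h⟩ := ih (c ++ v ++ d) (shortlex_append_append huv c d)
    exact ⟨y, hy, .trans _ _ _ (.rel _ _ ⟨c, d, rfl, rfl⟩) h⟩

/-- The pairs `(U, V)` with `uV = Uv` for an overlap of a suffix of `u` and a prefix of `v`. -/
def OverlapPair (u v : List A) (p : List A × List A) : Prop :=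
  ∃ y, u = p.1 ++ y ∧ v = y ++ p.2

/-- In a word `…vY`, with `Y` made of suffixes of `v`, no rewriting `u → v` that starts inside `v`
is created to the right of `v`. -/
def RewritesLeftwards (u v : List A) : Prop :=
  ∀ x y v' s z r Y W : List A, u = x ++ y → v = y ++ v' → x ≠ [] → y ≠ [] →
    u = s ++ z → v = r ++ s → s ≠ [] → z ≠ [] → v' ++ Y = z ++ W → (∀ b ∈ Y, b ∈ v) → False

/-- Induction on the length of `α`. An occurrence of `u` in `αvY` lies neither in `α` nor in `vY`,
so it starts in `α`; since `|u| = |v|`, it ends inside `v`. Rewriting it shortens `α` and replaces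
`Y` by `v'Y`, again made of letters of `v`. -/
theorem exists_leftward_rewriting {u v : List A} (hl : u.length = v.length) (hne : u ≠ v)
    (hL : RewritesLeftwards u v) (n : ℕ) : ∀ (α Y : List A), α.length ≤ n → Irr u α →
    Irr u (v ++ Y) → (∀ b ∈ Y, b ∈ v) →
    ∃ (γ : List A) (ts : List (List A × List A)), (∀ p ∈ ts, OverlapPair u v p) ∧
      α = γ ++ (ts.map Prod.fst).flatten ∧ Irr u (γ ++ v ++ (ts.map Prod.snd).flatten ++ Y) := by
  induction n with
  | zero =>
    intro α Y hn _ hY _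
    have : α = [] := List.eq_nil_of_length_eq_zero (by omega)
    subst this
    exact ⟨[], [], by simp, by simp, by simpa using hY⟩
  | succ n ih =>
    intro α Y hn hα hY hYv
    by_cases hI : Irr u (α ++ (v ++ Y))
    · exact ⟨α, [], by simp, by simp, by simpa using hI⟩
    obtain ⟨c, d, e⟩ := not_not.1 hI
    rw [List.append_assoc] at e
    rcases List.append_eq_append_iff.1 e with ⟨x, rfl, e1⟩ | ⟨x, rfl, e1⟩
    swap
    · exact absurd ⟨x, d, by simpa using e1.symm⟩ hY
    rcases List.append_eq_append_iff.1 e1 with ⟨w, rfl, e2⟩ | ⟨y, rfl, e2⟩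
    · exact absurd ⟨c, w, by simp⟩ hα
    have hx : x ≠ [] := by
      rintro rfl
      exact hY ⟨[], d, by simpa using e2.symm⟩
    have hy : y ≠ [] := by
      rintro rfl
      exact hα ⟨c, [], by simp⟩
    obtain ⟨v', rfl, rfl⟩ : ∃ v', v = y ++ v' ∧ d = v' ++ Y := by
      rcases List.append_eq_append_iff.1 e2 with ⟨v', h3, h4⟩ | ⟨v', h3, h4⟩
      · have h5 := congrArg List.length h3
        simp only [List.length_append] at h5 hl
        have h6 : x = [] := List.eq_nil_of_length_eq_zero (by omega)
        exact absurd h6 hx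
      · exact ⟨v', h3, h4⟩
    have hxl : 0 < x.length := List.length_pos_iff.2 hx
    -- An occurrence starting after the new `v` would lie in the irreducible `vY`, one contained in
    -- `v` would force `u = v`, and one that starts inside `v` and runs past its end is what `hL`
    -- excludes.
    have hI' : Irr (x ++ y) ((y ++ v') ++ (v' ++ Y)) := by
      rintro ⟨r, W, e3⟩
      rw [List.append_assoc] at e3
      rcases List.append_eq_append_iff.1 e3 with ⟨s, h3, h4⟩ | ⟨s, rfl, h4⟩
      swap
      · exact hY ⟨y ++ s, W, by simp [h4]⟩
      rcases List.append_eq_append_iff.1 h4 with ⟨w, rfl, h5⟩ | ⟨z, h5, h6⟩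
      · have h7 := congrArg List.length h3
        simp only [List.length_append] at h7 hl
        have h8 : r = [] := List.eq_nil_of_length_eq_zero (by omega)
        have h9 : w = [] := List.eq_nil_of_length_eq_zero (by omega)
        subst h8 h9
        exact hne (by simpa using h3.symm)
      · refine hL x y v' s z r Y W rfl rfl hx hy h5 h3 ?_ ?_ h6 hYv
        · rintro rfl
          refine hY ⟨y, W, ?_⟩
          rw [h5]
          simp [h6]
        · rintro rfl
          rw [List.append_nil] at h5
          subst h5
          have h7 := congrArg List.length h3
          simp only [List.length_append] at h7 hl
          have h8 : r = [] := List.eq_nil_of_length_eq_zero (by omega)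
          subst h8
          exact hne (by simpa using h3.symm)
    obtain ⟨γ, ts, hts, rfl, hirr⟩ := ih c (v' ++ Y)
      (by simp only [List.length_append] at hn; omega)
      (hα.of_infix ⟨[], x, by simp⟩) hI' (by
        intro b hb
        rcases List.mem_append.1 hb with hb | hb
        · exact List.mem_append_right _ hb
        · exact hYv b hb)
    -- Rewriting moves to the left, so the pair found first is the rightmost one.
    refine ⟨γ, ts ++ [(x, v')], ?_, by simp, by simpa using hirr⟩
    intro p hp
    rcases List.mem_append.1 hp with hp | hp
    · exact hts p hp
    · rw [List.mem_singleton.1 hp]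
      exact ⟨y, rfl, rfl⟩

/-- For an overlap pair, `Uv` and `uV` are the same word `UyV`. Each rewriting thus turns `Uv = uV`
into `vV`, carrying `v` one block to the left. -/
theorem conv_flatten_overlaps {u v : List A} (ts : List (List A × List A))
    (h : ∀ p ∈ ts, OverlapPair u v p) :
    Conv u v ((ts.map Prod.fst).flatten ++ u) (v ++ (ts.map Prod.snd).flatten) := by
  induction ts with
  | nil => exact .rel _ _ ⟨[], [], by simp, by simp⟩
  | cons p ts ih =>
    obtain ⟨U, V⟩ := p
    obtain ⟨y, e1, e2⟩ := h (U, V) (by simp)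
    simp only at e1 e2
    have h1 := (ih fun p hp => h p (by simp [hp])).append U []
    have h2 : U ++ (v ++ (ts.map Prod.snd).flatten) ++ []
        = u ++ (V ++ (ts.map Prod.snd).flatten) := by
      rw [e1, e2]; simp
    rw [h2] at h1
    refine .trans _ _ _ (by simpa [Conv] using h1) (.rel _ _ ⟨[], V ++ (ts.map Prod.snd).flatten, ?_, ?_⟩)
      <;> simp

/-- `β` is an explicit result of rewriting `αa` by leftward moving rewritings `u → v`. -/
def ExplicitMul (u v : List A) (a : A) (α β : List A) : Prop :=
  β = α ++ [a] ∨ ∃ (γ : List A) (ts : List (List A × List A)), (∀ p ∈ ts, OverlapPair u v p) ∧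
    α ++ [a] = γ ++ (ts.map Prod.fst).flatten ++ u ∧ β = γ ++ v ++ (ts.map Prod.snd).flatten

theorem ExplicitMul.conv {u v : List A} {a : A} {α β : List A} (h : ExplicitMul u v a α β) :
    Conv u v (α ++ [a]) β := by
  rcases h with rfl | ⟨γ, ts, hts, e, rfl⟩
  · exact .refl _
  · rw [e]
    simpa using (conv_flatten_overlaps ts hts).append γ []

/-- If `αa` is reducible, irreducibility of `α` forces `u` to be a suffix. The leftward chain then
ends in an irreducible word, which is `β` by uniqueness. The converse needs no irreducibility, so
`ExplicitMul` may be recognised on all words and restricted to normal forms afterwards. -/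
theorem conv_iff_explicitMul {u v : List A} (hl : u.length = v.length) (hne : u ≠ v)
    (hL : RewritesLeftwards u v)
    (hU : ∀ x y, Irr u x → Irr u y → Conv u v x y → x = y) {a : A} {α β : List A}
    (hα : Irr u α) (hβ : Irr u β) : Conv u v (α ++ [a]) β ↔ ExplicitMul u v a α β := by
  refine ⟨fun h => ?_, ExplicitMul.conv⟩
  by_cases hI : Irr u (α ++ [a])
  · exact Or.inl (hU _ _ hI hβ h).symm
  obtain ⟨c, d, e⟩ := not_not.1 hI
  rcases List.eq_nil_or_concat' d with rfl | ⟨d, b, rfl⟩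
  swap
  · rw [← List.append_assoc] at e
    exact absurd ⟨c, d, List.append_inj_left' e (by simp)⟩ hα
  rw [List.append_nil] at e
  have hu : u ≠ [] := by
    rintro rfl
    exact hne (List.eq_nil_of_length_eq_zero hl.symm).symm
  have hc : Irr u c := by
    obtain ⟨u', b, rfl⟩ := (List.eq_nil_or_concat' u).resolve_left hu
    rw [← List.append_assoc] at e
    exact hα.of_infix ⟨[], u', by simpa using List.append_inj_left' e (by simp)⟩
  have hv : Irr u (v ++ []) := by
    intro h'
    rw [List.append_nil] at h'
    exact hne (h'.eq_of_length hl)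
  obtain ⟨γ, ts, hts, rfl, hirr⟩ :=
    exists_leftward_rewriting hl hne hL c.length c [] le_rfl hc hv (by simp)
  rw [List.append_nil] at hirr
  have hE : ExplicitMul u v a α (γ ++ v ++ (ts.map Prod.snd).flatten) :=
    Or.inr ⟨γ, ts, hts, e.symm, rfl⟩
  rwa [hU _ _ hβ hirr (.trans _ _ _ (.symm _ _ h) hE.conv)]

end Rewriting
end OneRelator
namespace OneRelator

/-! ### Regularity of the multiplication relations on normal forms. -/

section Relations

variable {A : Type*}

theorem zip_inj {α β : Type*} {P P' : List α} {Q Q' : List β} (h : P.length = Q.length)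
    (h' : P'.length = Q'.length) (e : List.zip P Q = List.zip P' Q') : P = P' ∧ Q = Q' := by
  have h1 := congrArg (List.map Prod.fst) e
  have h2 := congrArg (List.map Prod.snd) e
  rw [List.map_fst_zip h.le, List.map_fst_zip h'.le] at h1
  rw [List.map_snd_zip h.ge, List.map_snd_zip h'.ge] at h2
  exact ⟨h1, h2⟩

/-- The pairs `(γ, γ)`, written letter by letter. -/
def diagLanguage (A : Type*) : Language (Option A × Option A) :=
  {w | ∃ γ : List A, w = List.zip (γ.map some) (γ.map some)}

open scoped Computability in
theorem diagLanguage_isRegular [Finite A] : (diagLanguage A).IsRegular := by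
  have h : (Set.range fun a : A => [(some a, some a)]).Finite := Set.finite_range _
  refine isRegular_of_mem_iff (isRegular_kstar (isRegular_finite h)) fun w =>
    Iff.trans ?_ Language.mem_kstar.symm
  constructor
  · rintro ⟨γ, rfl⟩
    refine ⟨γ.map fun a => [(some a, some a)], ?_, ?_⟩
    · induction γ with
      | nil => rfl
      | cons a γ ih => simp [ih]
    · intro y hy
      obtain ⟨a, _, rfl⟩ := List.mem_map.1 hy
      exact ⟨a, rfl⟩
  · rintro ⟨l, rfl, hl⟩
    induction l with
    | nil => exact ⟨[], rfl⟩
    | cons y l ih =>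
      obtain ⟨γ, e⟩ := ih fun y hy => hl y (by simp [hy])
      obtain ⟨a, ha⟩ := hl y (by simp)
      exact ⟨a :: γ, by simp [e, ← ha]⟩

/-- The pairs `($γ, γc)`, written letter by letter. -/
def shiftedDiagLanguage (c : A) : Language (Option A × Option A) :=
  {w | ∃ γ : List A, w = List.zip (none :: γ.map some) (γ.map some ++ [some c])}

/-- A delay of the diagonal by one letter gives `(γc, $γ)`; the components are then swapped. -/
theorem shiftedDiagLanguage_isRegular [Finite A] (c : A) :
    (shiftedDiagLanguage c).IsRegular := by
  have h := delay_isRegular (diagLanguage_isRegular (A := A)) [some c] [none] rfl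
  refine isRegular_of_mem_iff (isRegular_map_preimage h Prod.swap) fun w => ?_
  constructor
  · rintro ⟨γ, rfl⟩
    exact ⟨γ.map some, γ.map some, rfl, ⟨γ, rfl⟩, List.zip_swap _ _⟩
  · rintro ⟨P, Q, hl, ⟨γ, e⟩, hw⟩
    obtain ⟨rfl, rfl⟩ := zip_inj hl (by simp) e
    refine ⟨γ, ?_⟩
    have := congrArg (List.map Prod.swap) hw
    rw [List.zip_swap, List.map_map] at this
    simpa using this

/-- The pairs `(U₁⋯Uₘ, V₁⋯Vₘ)` of products of overlap pairs, written letter by letter. -/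
def overlapsLanguage (u v : List A) : Language (Option A × Option A) :=
  {w | ∃ ts : List (List A × List A), (∀ p ∈ ts, OverlapPair u v p) ∧
    w = List.zip ((ts.map Prod.fst).flatten.map some) ((ts.map Prod.snd).flatten.map some)}

theorem OverlapPair.length_eq {u v : List A} (hl : u.length = v.length) {p : List A × List A}
    (h : OverlapPair u v p) : p.1.length = p.2.length := by
  obtain ⟨y, rfl, rfl⟩ := h
  simp only [List.length_append] at hl
  omega

theorem length_flatten_overlaps {u v : List A} (hl : u.length = v.length)
    {ts : List (List A × List A)} (h : ∀ p ∈ ts, OverlapPair u v p) :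
    (ts.map Prod.fst).flatten.length = (ts.map Prod.snd).flatten.length := by
  induction ts with
  | nil => rfl
  | cons p ts ih =>
    simp only [List.map_cons, List.flatten_cons, List.length_append]
    rw [(h p (by simp)).length_eq hl, ih fun p hp => h p (by simp [hp])]

theorem finite_overlapPair (u v : List A) : {p | OverlapPair u v p}.Finite := by
  refine (((Set.finite_Iic u.length).image u.take).prod
    ((Set.finite_Iic v.length).image v.drop)).subset ?_
  rintro ⟨U, V⟩ ⟨y, e1, e2⟩
  simp only at e1 e2
  exact ⟨⟨U.length, by simp [e1], by simp [e1]⟩, ⟨y.length, by simp [e2], by simp [e2]⟩⟩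

open scoped Computability in
-- Since `|U| = |V|` for each overlap pair, zipping commutes with concatenation of the blocks, and
-- the language is the star of a finite set.
theorem overlapsLanguage_isRegular {u v : List A} (hl : u.length = v.length) :
    (overlapsLanguage u v).IsRegular := by
  have h := (finite_overlapPair u v).image
    fun p => List.zip (p.1.map some) (p.2.map some)
  refine isRegular_of_mem_iff (isRegular_kstar (isRegular_finite h)) fun w =>
    Iff.trans ?_ Language.mem_kstar.symm
  constructor
  · rintro ⟨ts, hts, rfl⟩
    refine ⟨ts.map fun p => List.zip (p.1.map some) (p.2.map some), ?_, ?_⟩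
    · induction ts with
      | nil => rfl
      | cons p ts ih =>
        have := (hts p (by simp)).length_eq hl
        simp only [List.map_cons, List.flatten_cons, List.map_append]
        rw [List.zip_append (by simpa using this), ih fun p hp => hts p (by simp [hp])]
    · intro y hy
      obtain ⟨p, hp, rfl⟩ := List.mem_map.1 hy
      exact ⟨p, hts p hp, rfl⟩
  · rintro ⟨l, rfl, hl'⟩
    induction l with
    | nil => exact ⟨[], by simp, rfl⟩
    | cons y l ih =>
      obtain ⟨ts, hts, e⟩ := ih fun y hy => hl' y (by simp [hy])
      obtain ⟨p, hp, rfl⟩ := hl' y (by simp)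
      have := OverlapPair.length_eq hl hp
      refine ⟨p :: ts, ?_, ?_⟩
      · intro q hq
        rcases List.mem_cons.1 hq with rfl | hq
        exacts [hp, hts q hq]
      · simp only [List.map_cons, List.flatten_cons, List.map_append]
        rw [List.zip_append (by simpa using this), e]

/-- The pairs `(U₁⋯Uₘ C, D V₁⋯Vₘ)` for products of overlap pairs, written letter by letter. -/
theorem mem_delay_overlapsLanguage {u v : List A} (hl : u.length = v.length)
    {C D : List (Option A)} {w : List (Option A × Option A)} :
    w ∈ delay (overlapsLanguage u v) C D ↔
      ∃ ts : List (List A × List A), (∀ p ∈ ts, OverlapPair u v p) ∧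
        w = List.zip ((ts.map Prod.fst).flatten.map some ++ C)
          (D ++ (ts.map Prod.snd).flatten.map some) := by
  constructor
  · rintro ⟨P, Q, h, ⟨ts, hts, e⟩, rfl⟩
    obtain ⟨rfl, rfl⟩ := zip_inj h (by
      rw [List.length_map, List.length_map]; exact length_flatten_overlaps hl hts) e
    exact ⟨ts, hts, rfl⟩
  · rintro ⟨ts, hts, rfl⟩
    exact ⟨_, _, by
      rw [List.length_map, List.length_map]; exact length_flatten_overlaps hl hts, ⟨ts, hts, rfl⟩, rfl⟩


/-- The pairs `(α$, β)` with `β` an explicit product of `α` and `a`, written letter by letter. -/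
theorem isRegular_explicitMul_right [Finite A] {u v : List A} (hl : u.length = v.length)
    (hu : u ≠ []) (a : A) :
    Language.IsRegular ({w | ∃ α β, ExplicitMul u v a α β ∧
      w = List.zip (α.map some ++ [none]) (β.map some)} : Language (Option A × Option A)) := by
  obtain ⟨u', b, rfl⟩ := (List.eq_nil_or_concat' u).resolve_left hu
  have h1 := isRegular_mul (diagLanguage_isRegular (A := A))
    (isRegular_singleton [((none : Option A), some a)])
  have h2 := isRegular_mul (diagLanguage_isRegular (A := A))
    (delay_isRegular (overlapsLanguage_isRegular hl) (u'.map some ++ [none]) (v.map some)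
      (by simpa using hl))
  have e1 : ∀ w : List (Option A × Option A),
      w ∈ diagLanguage A * ({[(none, some a)]} : Language (Option A × Option A)) ↔
      ∃ α : List A, w = List.zip (α.map some ++ [none]) ((α ++ [a]).map some) := by
    intro w
    rw [Language.mem_mul]
    constructor
    · rintro ⟨_, ⟨γ, rfl⟩, _, rfl, rfl⟩
      refine ⟨γ, ?_⟩
      rw [List.map_append, List.zip_append rfl]
      rfl
    · rintro ⟨γ, rfl⟩
      refine ⟨_, ⟨γ, rfl⟩, _, rfl, ?_⟩
      rw [List.map_append, List.zip_append rfl]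
      rfl
  have e2 : ∀ w : List (Option A × Option A), w ∈ diagLanguage A *
      delay (overlapsLanguage (u' ++ [b]) v) (u'.map some ++ [none]) (v.map some) ↔
      ∃ (γ : List A) (ts : List (List A × List A)),
        (∀ p ∈ ts, OverlapPair (u' ++ [b]) v p) ∧
        w = List.zip ((γ ++ (ts.map Prod.fst).flatten ++ u').map some ++ [none])
          ((γ ++ v ++ (ts.map Prod.snd).flatten).map some) := by
    intro w
    rw [Language.mem_mul]
    constructor
    · rintro ⟨_, ⟨γ, rfl⟩, d, hd, rfl⟩
      obtain ⟨ts, hts, rfl⟩ := (mem_delay_overlapsLanguage hl).1 hd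
      refine ⟨γ, ts, hts, ?_⟩
      rw [← List.zip_append rfl]
      simp only [List.map_append, List.append_assoc]
    · rintro ⟨γ, ts, hts, rfl⟩
      refine ⟨_, ⟨γ, rfl⟩, _, (mem_delay_overlapsLanguage hl).2 ⟨ts, hts, rfl⟩, ?_⟩
      rw [← List.zip_append rfl]
      simp only [List.map_append, List.append_assoc]
  by_cases hab : b = a
  · subst hab
    refine isRegular_of_mem_iff (h1.add h2) fun w => ?_
    rw [Language.mem_add, e1, e2]
    constructor
    · rintro ⟨α, β, rfl | ⟨γ, ts, hts, e, rfl⟩, rfl⟩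
      · exact Or.inl ⟨α, rfl⟩
      · rw [← List.append_assoc] at e
        rw [List.append_inj_left' e rfl]
        exact Or.inr ⟨γ, ts, hts, rfl⟩
    · rintro (⟨α, rfl⟩ | ⟨γ, ts, hts, rfl⟩)
      · exact ⟨α, _, Or.inl rfl, rfl⟩
      · exact ⟨_, _, Or.inr ⟨γ, ts, hts, by simp, rfl⟩, rfl⟩
  · refine isRegular_of_mem_iff h1 fun w => ?_
    rw [e1]
    constructor
    · rintro ⟨α, β, rfl | ⟨γ, ts, hts, e, rfl⟩, rfl⟩
      · exact ⟨α, rfl⟩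
      · rw [← List.append_assoc] at e
        have := List.append_inj_right' e rfl
        simp only [List.cons.injEq, and_true] at this
        exact absurd this.symm hab
    · rintro ⟨α, rfl⟩
      exact ⟨α, _, Or.inl rfl, rfl⟩

/-- The pairs `($α, β)` with `β` an explicit product of `α` and `a`, written letter by letter. -/
theorem isRegular_explicitMul_left [Finite A] {u v : List A} (hl : u.length = v.length)
    (hu : u ≠ []) (a : A) :
    Language.IsRegular ({w | ∃ α β, ExplicitMul u v a α β ∧
      w = List.zip (none :: α.map some) (β.map some)} : Language (Option A × Option A)) := by
  obtain ⟨u', b, rfl⟩ := (List.eq_nil_or_concat' u).resolve_left hu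
  obtain ⟨c, v', rfl⟩ : ∃ c v', v = c :: v' := by
    rcases v with _ | ⟨c, v'⟩
    · simp at hl
    · exact ⟨c, v', rfl⟩
  have h1 := shiftedDiagLanguage_isRegular a
  have h2 := isRegular_mul (shiftedDiagLanguage_isRegular c)
    (delay_isRegular (overlapsLanguage_isRegular hl) (u'.map some) (v'.map some)
      (by simpa using hl))
  have e1 : ∀ w : List (Option A × Option A), w ∈ shiftedDiagLanguage a ↔
      ∃ α : List A, w = List.zip (none :: α.map some) ((α ++ [a]).map some) := by
    intro w
    simp only [List.map_append]
    exact Iff.rfl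
  have e2 : ∀ w : List (Option A × Option A), w ∈ shiftedDiagLanguage c *
      delay (overlapsLanguage (u' ++ [b]) (c :: v')) (u'.map some) (v'.map some) ↔
      ∃ (γ : List A) (ts : List (List A × List A)),
        (∀ p ∈ ts, OverlapPair (u' ++ [b]) (c :: v') p) ∧
        w = List.zip (none :: (γ ++ (ts.map Prod.fst).flatten ++ u').map some)
          ((γ ++ c :: v' ++ (ts.map Prod.snd).flatten).map some) := by
    intro w
    rw [Language.mem_mul]
    constructor
    · rintro ⟨_, ⟨γ, rfl⟩, d, hd, rfl⟩
      obtain ⟨ts, hts, rfl⟩ := (mem_delay_overlapsLanguage hl).1 hd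
      refine ⟨γ, ts, hts, ?_⟩
      rw [← List.zip_append (by simp)]
      simp
    · rintro ⟨γ, ts, hts, rfl⟩
      refine ⟨_, ⟨γ, rfl⟩, _, (mem_delay_overlapsLanguage hl).2 ⟨ts, hts, rfl⟩, ?_⟩
      rw [← List.zip_append (by simp)]
      simp
  by_cases hab : b = a
  · subst hab
    refine isRegular_of_mem_iff (h1.add h2) fun w => ?_
    rw [Language.mem_add, e1, e2]
    constructor
    · rintro ⟨α, β, rfl | ⟨γ, ts, hts, e, rfl⟩, rfl⟩
      · exact Or.inl ⟨α, rfl⟩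
      · rw [← List.append_assoc] at e
        rw [List.append_inj_left' e rfl]
        exact Or.inr ⟨γ, ts, hts, rfl⟩
    · rintro (⟨α, rfl⟩ | ⟨γ, ts, hts, rfl⟩)
      · exact ⟨α, _, Or.inl rfl, rfl⟩
      · exact ⟨_, _, Or.inr ⟨γ, ts, hts, by simp, rfl⟩, rfl⟩
  · refine isRegular_of_mem_iff h1 fun w => ?_
    rw [e1]
    constructor
    · rintro ⟨α, β, rfl | ⟨γ, ts, hts, e, rfl⟩, rfl⟩
      · exact ⟨α, rfl⟩
      · rw [← List.append_assoc] at e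
        have := List.append_inj_right' e rfl
        simp only [List.cons.injEq, and_true] at this
        exact absurd this.symm hab
    · rintro ⟨α, rfl⟩
      exact ⟨α, _, Or.inl rfl, rfl⟩

/-- The nonempty words without factor `u`. -/
def normalLanguage (u : List A) : Language A := {x | x ≠ [] ∧ Irr u x}

theorem normalLanguage_isRegular (u : List A) : (normalLanguage u).IsRegular := by
  have hT := isRegular_top (α := A)
  refine isRegular_of_mem_iff ((isRegular_singleton ([] : List A)).add
    (isRegular_mul (isRegular_mul hT (isRegular_singleton u)) hT)).compl fun x => ?_
  change _ ↔ ¬ (x = [] ∨ x ∈ _ * _ * _)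
  rw [not_or]
  refine and_congr Iff.rfl (not_congr ?_)
  constructor
  · rintro ⟨c, d, rfl⟩
    exact Language.append_mem_mul (Language.append_mem_mul trivial rfl) trivial
  · rintro ⟨_, ⟨c, _, _, rfl, rfl⟩, d, _, rfl⟩
    exact ⟨c, d, rfl⟩

theorem reverse_mem_normalLanguage {u x : List A} :
    x.reverse ∈ normalLanguage u.reverse ↔ x ∈ normalLanguage u :=
  and_congr (by simp) irr_reverse_iff

/-- The relation `αa = β` on normal forms. -/
def RightMulNormal (u v : List A) (a : A) (α β : List A) : Prop :=
  α ∈ normalLanguage u ∧ β ∈ normalLanguage u ∧ Conv u v (α ++ [a]) β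

/-- The relation `aα = β` on normal forms. -/
def LeftMulNormal (u v : List A) (a : A) (α β : List A) : Prop :=
  α ∈ normalLanguage u ∧ β ∈ normalLanguage u ∧ Conv u v (a :: α) β

theorem leftMulNormal_reverse_iff {u v : List A} {a : A} {α β : List A} :
    RightMulNormal u.reverse v.reverse a α.reverse β.reverse ↔ LeftMulNormal u v a α β := by
  refine and_congr reverse_mem_normalLanguage (and_congr reverse_mem_normalLanguage ?_)
  rw [← List.reverse_cons]
  exact conv_reverse_iff

theorem RightMulNormal.length_eq {u v : List A} (hl : u.length = v.length) {a : A}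
    {α β : List A} (h : RightMulNormal u v a α β) : β.length = α.length + 1 := by
  simpa using (h.2.2.length_eq hl).symm

theorem LeftMulNormal.length_eq {u v : List A} (hl : u.length = v.length) {a : A}
    {α β : List A} (h : LeftMulNormal u v a α β) : β.length = α.length + 1 := by
  simpa using (h.2.2.length_eq hl).symm

theorem filterMap_fst_zip {x y : List (Option A)} (h : x.length = y.length) :
    (List.zip x y).filterMap Prod.fst = x.filterMap id := by
  conv_rhs => rw [← List.map_fst_zip h.le]
  rw [List.filterMap_map]
  rfl

theorem filterMap_snd_zip {x y : List (Option A)} (h : x.length = y.length) :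
    (List.zip x y).filterMap Prod.snd = y.filterMap id := by
  conv_rhs => rw [← List.map_snd_zip h.ge]
  rw [List.filterMap_map]
  rfl

theorem filterMap_id_map_some (x : List A) : (x.map some).filterMap id = x := by
  simp [List.filterMap_map]

/-- The data of a length preserving rule `u → v` with unique normal forms for which rewriting
proceeds to the left after a multiplication on the right. -/
structure LeftwardSystem (u v : List A) : Prop where
  length_eq : u.length = v.length
  ne : u ≠ v
  leftwards : RewritesLeftwards u v
  unique : ∀ x y, Irr u x → Irr u y → Conv u v x y → x = y

theorem LeftwardSystem.ne_nil {u v : List A} (h : LeftwardSystem u v) : u ≠ [] := by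
  rintro rfl
  exact h.ne (List.eq_nil_of_length_eq_zero h.length_eq.symm).symm

/-- `f` and `g` stand for the padded components. As erasing `$` recovers the words, normality of `α`
and of `β` is a regular condition on each projection and can be intersected with the explicit
relation. -/
theorem isRegular_rightMulNormal_aux {u v : List A} (h : LeftwardSystem u v) (a : A)
    (f g : List A → List (Option A)) (hf : ∀ x, (f x).filterMap id = x)
    (hg : ∀ x, (g x).filterMap id = x)
    (hlen : ∀ x y, y.length = x.length + 1 → (f x).length = (g y).length)
    (hR : Language.IsRegular ({w | ∃ α β, ExplicitMul u v a α β ∧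
      w = List.zip (f α) (g β)} : Language (Option A × Option A))) :
    Language.IsRegular ({w | ∃ α β, RightMulNormal u v a α β ∧
      w = List.zip (f α) (g β)} : Language (Option A × Option A)) := by
  refine isRegular_of_mem_iff ((hR.inf (isRegular_filterMap (normalLanguage_isRegular u)
    Prod.fst)).inf (isRegular_filterMap (normalLanguage_isRegular u) Prod.snd)) fun w => ?_
  constructor
  · rintro ⟨α, β, hαβ, rfl⟩
    have hl := hlen _ _ (hαβ.length_eq h.length_eq)
    have h1 := hαβ.1
    have h2 := hαβ.2.1
    rw [← hf α, ← filterMap_fst_zip hl] at h1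
    rw [← hg β, ← filterMap_snd_zip hl] at h2
    refine ⟨⟨⟨α, β, (conv_iff_explicitMul h.length_eq h.ne h.leftwards h.unique hαβ.1.2
      hαβ.2.1.2).1 hαβ.2.2, rfl⟩, h1⟩, h2⟩
  · rintro ⟨⟨⟨α, β, hαβ, rfl⟩, h1⟩, h2⟩
    have hl := hlen α β (by simpa using (hαβ.conv.length_eq h.length_eq).symm)
    change List.filterMap Prod.fst _ ∈ normalLanguage u at h1
    change List.filterMap Prod.snd _ ∈ normalLanguage u at h2
    rw [filterMap_fst_zip hl, hf] at h1
    rw [filterMap_snd_zip hl, hg] at h2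
    exact ⟨α, β, ⟨h1, h2, hαβ.conv⟩, rfl⟩

theorem isRegular_rightMulNormal_right [Finite A] {u v : List A} (h : LeftwardSystem u v)
    (a : A) : Language.IsRegular ({w | ∃ α β, RightMulNormal u v a α β ∧
      w = List.zip (α.map some ++ [none]) (β.map some)} : Language (Option A × Option A)) :=
  isRegular_rightMulNormal_aux h a (fun α => α.map some ++ [none]) (fun β => β.map some)
    (fun x => by simp [List.filterMap_map]) filterMap_id_map_some (by simp +contextual)
    (isRegular_explicitMul_right h.length_eq h.ne_nil a)

theorem isRegular_rightMulNormal_left [Finite A] {u v : List A} (h : LeftwardSystem u v)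
    (a : A) : Language.IsRegular ({w | ∃ α β, RightMulNormal u v a α β ∧
      w = List.zip (none :: α.map some) (β.map some)} : Language (Option A × Option A)) :=
  isRegular_rightMulNormal_aux h a (fun α => none :: α.map some) (fun β => β.map some)
    (fun x => by simp [List.filterMap_map]) filterMap_id_map_some (by simp +contextual)
    (isRegular_explicitMul_left h.length_eq h.ne_nil a)

theorem reverse_zip {α β : Type*} {x : List α} {y : List β} (h : x.length = y.length) :
    (List.zip x y).reverse = List.zip x.reverse y.reverse := by
  induction x generalizing y with
  | nil => simp
  | cons a x ih =>
    rcases y with _ | ⟨b, y⟩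
    · simp at h
    · have h' : x.length = y.length := by simpa using h
      simp only [List.zip_cons_cons, List.reverse_cons, ih h']
      rw [List.zip_append (by simpa using h')]
      rfl

/-- Reversal exchanges left and right multiplication and also moves the `$` from one end to the
other. -/
theorem isRegular_leftMulNormal_left [Finite A] {u v : List A}
    (h : LeftwardSystem u.reverse v.reverse) (a : A) :
    Language.IsRegular ({w | ∃ α β, LeftMulNormal u v a α β ∧
      w = List.zip (none :: α.map some) (β.map some)} : Language (Option A × Option A)) := by
  have hl : u.length = v.length := by simpa using h.length_eq
  refine isRegular_of_mem_iff (isRegular_rightMulNormal_right h a).reverse fun w =>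
    Iff.trans ?_ Language.mem_reverse.symm
  constructor
  · rintro ⟨α, β, hαβ, rfl⟩
    refine ⟨α.reverse, β.reverse, leftMulNormal_reverse_iff.2 hαβ, ?_⟩
    rw [reverse_zip (by simp [hαβ.length_eq hl])]
    simp
  · rintro ⟨α, β, hαβ, e⟩
    have hl' := hαβ.length_eq h.length_eq
    rw [← α.reverse_reverse, ← β.reverse_reverse, leftMulNormal_reverse_iff] at hαβ
    refine ⟨_, _, hαβ, ?_⟩
    rw [← w.reverse_reverse, e, reverse_zip (by simp [hl'])]
    simp

theorem isRegular_leftMulNormal_right [Finite A] {u v : List A}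
    (h : LeftwardSystem u.reverse v.reverse) (a : A) :
    Language.IsRegular ({w | ∃ α β, LeftMulNormal u v a α β ∧
      w = List.zip (α.map some ++ [none]) (β.map some)} : Language (Option A × Option A)) := by
  have hl : u.length = v.length := by simpa using h.length_eq
  refine isRegular_of_mem_iff (isRegular_rightMulNormal_left h a).reverse fun w =>
    Iff.trans ?_ Language.mem_reverse.symm
  constructor
  · rintro ⟨α, β, hαβ, rfl⟩
    refine ⟨α.reverse, β.reverse, leftMulNormal_reverse_iff.2 hαβ, ?_⟩
    rw [reverse_zip (by simp [hαβ.length_eq hl])]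
    simp
  · rintro ⟨α, β, hαβ, e⟩
    have hl' := hαβ.length_eq h.length_eq
    rw [← α.reverse_reverse, ← β.reverse_reverse, leftMulNormal_reverse_iff] at hαβ
    refine ⟨_, _, hαβ, ?_⟩
    rw [← w.reverse_reverse, e, reverse_zip (by simp [hl'])]
    simp

end Relations
end OneRelator
namespace OneRelator

/-! ### From words to the semigroup, and from zipped pairs to the padded languages. -/

section Semigroup

variable {A : Type*}

theorem word_mul (x y : FreeSemigroup A) : word (x * y) = word x ++ word y := rfl

theorem word_ne_nil (x : FreeSemigroup A) : word x ≠ [] := by simp [word]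

theorem length_word (x : FreeSemigroup A) : (word x).length = x.length := rfl

theorem word_injective : Function.Injective (word (A := A)) := by
  rintro ⟨a, x⟩ ⟨b, y⟩ h
  simp only [word, List.cons.injEq] at h
  rw [h.1, h.2]

theorem exists_word_eq {x : List A} (h : x ≠ []) : ∃ X : FreeSemigroup A, word X = x := by
  rcases x with _ | ⟨a, x⟩
  · exact absurd rfl h
  · exact ⟨⟨a, x⟩, rfl⟩

theorem relatorCon_iff_conv {u v x y : FreeSemigroup A} :
    relatorCon u v x y ↔ Conv (word u) (word v) (word x) (word y) := by
  constructor
  · intro h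
    let c : Con (FreeSemigroup A) :=
      { r := fun x y => Conv (word u) (word v) (word x) (word y)
        iseqv := ⟨fun x => .refl _, fun h => .symm _ _ h, fun h h' => .trans _ _ _ h h'⟩
        mul' := by
          intro a b c d h h'
          rw [word_mul, word_mul]
          exact .trans _ _ _ (by simpa [Conv] using h.append [] (word c))
            (by simpa [Conv] using h'.append (word b) []) }
    refine (Con.conGen_le (c := c)).2 ?_ h
    rintro _ _ ⟨rfl, rfl⟩
    exact .rel _ _ ⟨[], [], by simp, by simp⟩
  -- The induction runs over all lists, while the congruence lives on non-empty words. Preservation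
  -- of emptiness is carried along so that the middle word of a transitivity step lifts to the free
  -- semigroup.
  · have key : ∀ p q : List A, Conv (word u) (word v) p q → (p = [] ↔ q = []) ∧
        ∀ x y, word x = p → word y = q → relatorCon u v x y := by
      intro p q h
      induction h with
      | rel p q h =>
        obtain ⟨c, d, rfl, rfl⟩ := h
        refine ⟨by simp [word_ne_nil], fun x y hx hy => ?_⟩
        have h0 : relatorCon u v u v := ConGen.Rel.of _ _ ⟨rfl, rfl⟩
        rcases eq_or_ne c [] with rfl | hc
        · rcases eq_or_ne d [] with rfl | hd
          · rw [List.append_nil, List.nil_append] at hx hy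
            rwa [word_injective hx, word_injective hy]
          · obtain ⟨D, rfl⟩ := exists_word_eq hd
            rw [List.nil_append, ← word_mul] at hx hy
            rw [word_injective hx, word_injective hy]
            exact (relatorCon u v).mul h0 ((relatorCon u v).refl _)
        · obtain ⟨C, rfl⟩ := exists_word_eq hc
          rcases eq_or_ne d [] with rfl | hd
          · rw [List.append_nil, ← word_mul] at hx hy
            rw [word_injective hx, word_injective hy]
            exact (relatorCon u v).mul ((relatorCon u v).refl _) h0
          · obtain ⟨D, rfl⟩ := exists_word_eq hd
            rw [← word_mul, ← word_mul] at hx hy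
            rw [word_injective hx, word_injective hy]
            exact (relatorCon u v).mul ((relatorCon u v).mul ((relatorCon u v).refl _) h0)
              ((relatorCon u v).refl _)
      | refl p =>
        refine ⟨Iff.rfl, fun x y hx hy => ?_⟩
        rw [word_injective (hx.trans hy.symm)]
        exact (relatorCon u v).refl _
      | symm p q _ ih =>
        exact ⟨ih.1.symm, fun x y hx hy => (relatorCon u v).symm (ih.2 y x hy hx)⟩
      | trans p q r _ _ h1 h2 =>
        refine ⟨h1.1.trans h2.1, fun x y hx hy => ?_⟩
        have hp : p ≠ [] := hx ▸ word_ne_nil x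
        obtain ⟨z, hz⟩ := exists_word_eq (mt h1.1.2 hp)
        exact (relatorCon u v).trans (h1.2 x z hx hz) (h2.2 z y hz hy)
    exact fun h => (key _ _ h).2 x y rfl rfl

/-- The canonical homomorphism `A⁺ → sgp⁺⟨A | u = v⟩`. -/
def toOneRelator (u v : FreeSemigroup A) : FreeSemigroup A →ₙ* OneRelatorSemigroup u v where
  toFun x := (x : (relatorCon u v).Quotient)
  map_mul' _ _ := rfl

theorem toOneRelator_eq_iff {u v x y : FreeSemigroup A} :
    toOneRelator u v x = toOneRelator u v y ↔ Conv (word u) (word v) (word x) (word y) :=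
  ((relatorCon u v).eq).trans relatorCon_iff_conv

/-- The set of normal forms, as a subset of `A⁺`. -/
def normalSet (u : FreeSemigroup A) : Set (FreeSemigroup A) := {x | Irr (word u) (word x)}

theorem word_mem_normalLanguage {u x : FreeSemigroup A} :
    word x ∈ normalLanguage (word u) ↔ x ∈ normalSet u :=
  ⟨fun h => h.2, fun h => ⟨word_ne_nil x, h⟩⟩

theorem toLanguage_normalSet (u : FreeSemigroup A) :
    toLanguage (normalSet u) = normalLanguage (word u) := by
  ext w
  constructor
  · rintro ⟨x, hx, rfl⟩
    exact word_mem_normalLanguage.2 hx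
  · intro h
    obtain ⟨x, rfl⟩ := exists_word_eq h.1
    exact ⟨x, word_mem_normalLanguage.1 h, rfl⟩

theorem padR_map_val_of_length {x y : List A} (h : y.length = x.length + 1) :
    (padR x y).map Subtype.val = List.zip (x.map some ++ [none]) (y.map some) := by
  induction x generalizing y with
  | nil =>
    obtain ⟨b, rfl⟩ := List.length_eq_one_iff.1 h
    simp [padR]
  | cons a x ih =>
    rcases y with _ | ⟨b, y⟩
    · simp at h
    · simp [padR, ih (y := y) (by simpa using h)]

theorem padR_self_map_val (x : List A) :
    (padR x x).map Subtype.val = List.zip (x.map some) (x.map some) := by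
  induction x with
  | nil => simp [padR]
  | cons a x ih => simp [padR, ih]

theorem padL_map_val_of_length {x y : List A} (h : y.length = x.length + 1) :
    (padL x y).map Subtype.val = List.zip (none :: x.map some) (y.map some) := by
  rw [padL, List.map_reverse, padR_map_val_of_length (by simpa using h),
    reverse_zip (by simp [h])]
  simp

theorem padL_self_map_val (x : List A) :
    (padL x x).map Subtype.val = List.zip (x.map some) (x.map some) := by
  rw [padL, List.map_reverse, padR_self_map_val, reverse_zip rfl]
  simp

/-- The inclusion of the padded alphabet into all pairs of options is injective, so regularity can
be checked there and pulled back. -/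
theorem isRegular_pad {U : FreeSemigroup A → FreeSemigroup A → Prop}
    (pad : List A → List A → List (PadAlphabet A)) {R : List A → List A → Prop}
    (f : List A → List A → List (Option A × Option A))
    (hU : ∀ x y, U x y ↔ R (word x) (word y))
    (hne : ∀ x y, R x y → x ≠ [] ∧ y ≠ [])
    (hpad : ∀ x y, R x y → (pad x y).map Subtype.val = f x y)
    (h : Language.IsRegular ({w | ∃ x y, R x y ∧ w = f x y} : Language (Option A × Option A))) :
    Language.IsRegular ({z | ∃ x y, U x y ∧ z = pad (word x) (word y)} :
      Language (PadAlphabet A)) := by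
  refine isRegular_of_mem_iff (isRegular_map_preimage h Subtype.val) fun z => ?_
  constructor
  · rintro ⟨x, y, hxy, rfl⟩
    have := (hU x y).1 hxy
    exact ⟨_, _, this, hpad _ _ this⟩
  · rintro ⟨x, y, hxy, e⟩
    obtain ⟨hx, hy⟩ := hne _ _ hxy
    obtain ⟨X, rfl⟩ := exists_word_eq hx
    obtain ⟨Y, rfl⟩ := exists_word_eq hy
    refine ⟨X, Y, (hU X Y).2 hxy, Subtype.val_injective.list_map ?_⟩
    rw [e, hpad _ _ hxy]

theorem isRegular_diag_normal [Finite A] (u : List A) :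
    Language.IsRegular ({w | ∃ x y, (x ∈ normalLanguage u ∧ x = y) ∧
      w = List.zip (x.map some) (x.map some)} : Language (Option A × Option A)) := by
  refine isRegular_of_mem_iff ((diagLanguage_isRegular (A := A)).inf
    (isRegular_filterMap (normalLanguage_isRegular u) Prod.fst)) fun w => ?_
  constructor
  · rintro ⟨x, y, ⟨hx, rfl⟩, rfl⟩
    refine ⟨⟨x, rfl⟩, ?_⟩
    rwa [← filterMap_id_map_some x, ← filterMap_fst_zip rfl] at hx
  · rintro ⟨⟨x, rfl⟩, hx⟩
    change List.filterMap Prod.fst _ ∈ normalLanguage u at hx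
    rw [filterMap_fst_zip rfl, filterMap_id_map_some] at hx
    exact ⟨x, x, ⟨hx, rfl⟩, rfl⟩

theorem isRegular_padR_diag [Finite A] {u : FreeSemigroup A}
    {U : FreeSemigroup A → FreeSemigroup A → Prop}
    (hU : ∀ x y, U x y ↔ x ∈ normalSet u ∧ x = y) : (padRLanguage U).IsRegular :=
  isRegular_pad padR (R := fun x y => x ∈ normalLanguage (word u) ∧ x = y)
    (fun x _ => List.zip (x.map some) (x.map some))
    (fun x y => by rw [hU, word_mem_normalLanguage, word_injective.eq_iff])
    (fun x y h => ⟨h.1.1, h.2 ▸ h.1.1⟩)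
    (fun x y h => by rw [← h.2, padR_self_map_val]) (isRegular_diag_normal _)

theorem isRegular_padL_diag [Finite A] {u : FreeSemigroup A}
    {U : FreeSemigroup A → FreeSemigroup A → Prop}
    (hU : ∀ x y, U x y ↔ x ∈ normalSet u ∧ x = y) : (padLLanguage U).IsRegular :=
  isRegular_pad padL (R := fun x y => x ∈ normalLanguage (word u) ∧ x = y)
    (fun x _ => List.zip (x.map some) (x.map some))
    (fun x y => by rw [hU, word_mem_normalLanguage, word_injective.eq_iff])
    (fun x y h => ⟨h.1.1, h.2 ▸ h.1.1⟩)
    (fun x y h => by rw [← h.2, padL_self_map_val]) (isRegular_diag_normal _)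

section Structures

variable {u v : FreeSemigroup A}

theorem isRegularRepresentation_normalSet [Finite A]
    (hE : ∀ x, ∃ y, Irr (word u) y ∧ Conv (word u) (word v) x y)
    (hl : (word u).length = (word v).length) :
    IsRegularRepresentation (toOneRelator u v) (normalSet u) where
  finite := inferInstance
  regular := by
    rw [toLanguage_normalSet]
    exact normalLanguage_isRegular _
  surjOn := by
    rw [Set.eq_univ_iff_forall]
    intro s
    obtain ⟨x, rfl⟩ : ∃ x, toOneRelator u v x = s := Quotient.exists_rep s
    obtain ⟨y, hy, hxy⟩ := hE (word x)
    have hne : y ≠ [] := by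
      rintro rfl
      have := hxy.length_eq hl
      simp [word] at this
    obtain ⟨Y, rfl⟩ := exists_word_eq hne
    exact ⟨Y, hy, (toOneRelator_eq_iff.2 hxy).symm⟩

theorem toOneRelator_eq_iff_of_normal (h : LeftwardSystem (word u) (word v))
    {x y : FreeSemigroup A} (hx : x ∈ normalSet u) (hy : y ∈ normalSet u) :
    toOneRelator u v x = toOneRelator u v y ↔ x = y := by
  refine ⟨fun e => ?_, fun e => e ▸ rfl⟩
  exact word_injective (h.unique _ _ hx hy (toOneRelator_eq_iff.1 e))

theorem diag_iff (h : LeftwardSystem (word u) (word v)) (x y : FreeSemigroup A) :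
    (x ∈ normalSet u ∧ y ∈ normalSet u ∧ toOneRelator u v x = toOneRelator u v y) ↔
      x ∈ normalSet u ∧ x = y := by
  constructor
  · rintro ⟨hx, hy, e⟩
    exact ⟨hx, (toOneRelator_eq_iff_of_normal h hx hy).1 e⟩
  · rintro ⟨hx, rfl⟩
    exact ⟨hx, hx, rfl⟩

theorem rightMulRel_iff (a : A) (x y : FreeSemigroup A) :
    RightMulRel (toOneRelator u v) (normalSet u) (some a) x y ↔
      RightMulNormal (word u) (word v) a (word x) (word y) := by
  simp only [RightMulRel, RightMulNormal, word_mem_normalLanguage, toOneRelator_eq_iff]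
  rfl

theorem leftMulRel_iff (a : A) (x y : FreeSemigroup A) :
    LeftMulRel (toOneRelator u v) (normalSet u) (some a) x y ↔
      LeftMulNormal (word u) (word v) a (word x) (word y) := by
  simp only [LeftMulRel, LeftMulNormal, word_mem_normalLanguage, toOneRelator_eq_iff]
  rfl

variable [Finite A]

theorem isRegular_padR_rightMul (h : LeftwardSystem (word u) (word v)) (a : Option A) :
    (padRLanguage (RightMulRel (toOneRelator u v) (normalSet u) a)).IsRegular := by
  rcases a with _ | a
  · exact isRegular_padR_diag (diag_iff h)
  · exact isRegular_pad padR (fun x y => List.zip (x.map some ++ [none]) (y.map some))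
      (rightMulRel_iff a) (fun x y h' => ⟨h'.1.1, h'.2.1.1⟩)
      (fun x y h' => padR_map_val_of_length (h'.length_eq h.length_eq))
      (isRegular_rightMulNormal_right h a)

theorem isRegular_padL_rightMul (h : LeftwardSystem (word u) (word v)) (a : Option A) :
    (padLLanguage (RightMulRel (toOneRelator u v) (normalSet u) a)).IsRegular := by
  rcases a with _ | a
  · exact isRegular_padL_diag (diag_iff h)
  · exact isRegular_pad padL (fun x y => List.zip (none :: x.map some) (y.map some))
      (rightMulRel_iff a) (fun x y h' => ⟨h'.1.1, h'.2.1.1⟩)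
      (fun x y h' => padL_map_val_of_length (h'.length_eq h.length_eq))
      (isRegular_rightMulNormal_left h a)

theorem isRegular_padR_leftMul (h : LeftwardSystem (word u) (word v))
    (h' : LeftwardSystem (word u).reverse (word v).reverse) (a : Option A) :
    (padRLanguage (LeftMulRel (toOneRelator u v) (normalSet u) a)).IsRegular := by
  rcases a with _ | a
  · exact isRegular_padR_diag (diag_iff h)
  · exact isRegular_pad padR (fun x y => List.zip (x.map some ++ [none]) (y.map some))
      (leftMulRel_iff a) (fun x y h' => ⟨h'.1.1, h'.2.1.1⟩)
      (fun x y h' => padR_map_val_of_length (h'.length_eq h.length_eq))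
      (isRegular_leftMulNormal_right h' a)

theorem isRegular_padL_leftMul (h : LeftwardSystem (word u) (word v))
    (h' : LeftwardSystem (word u).reverse (word v).reverse) (a : Option A) :
    (padLLanguage (LeftMulRel (toOneRelator u v) (normalSet u) a)).IsRegular := by
  rcases a with _ | a
  · exact isRegular_padL_diag (diag_iff h)
  · exact isRegular_pad padL (fun x y => List.zip (none :: x.map some) (y.map some))
      (leftMulRel_iff a) (fun x y h' => ⟨h'.1.1, h'.2.1.1⟩)
      (fun x y h' => padL_map_val_of_length (h'.length_eq h.length_eq))
      (isRegular_leftMulNormal_left h' a)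

/-- A prefix of a normal form is normal, so the relation is just equality on normal forms. -/
theorem isRegular_prefixRel (h : LeftwardSystem (word u) (word v)) :
    (padRLanguage (PrefixRel (toOneRelator u v) (normalSet u))).IsRegular := by
  refine isRegular_padR_diag (u := u) fun x y => ?_
  constructor
  · rintro ⟨hx, ⟨z, hz, hyz⟩, e⟩
    have hy : y ∈ normalSet u := Irr.of_infix hz hyz.isInfix
    exact ⟨hx, (toOneRelator_eq_iff_of_normal h hx hy).1 e⟩
  · rintro ⟨hx, rfl⟩
    exact ⟨hx, ⟨x, hx, List.prefix_refl _⟩, rfl⟩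

theorem isBiautomatic_and_isPrefixAutomatic (h : LeftwardSystem (word u) (word v))
    (h' : LeftwardSystem (word u).reverse (word v).reverse)
    (hE : ∀ x, ∃ y, Irr (word u) y ∧ Conv (word u) (word v) x y) :
    IsBiautomatic (OneRelatorSemigroup u v) ∧ IsPrefixAutomatic (OneRelatorSemigroup u v) := by
  have hreg := isRegularRepresentation_normalSet hE h.length_eq
  exact ⟨⟨A, toOneRelator u v, normalSet u,
    { hreg with
      left_left := isRegular_padL_leftMul h h'
      left_right := isRegular_padL_rightMul h
      right_left := isRegular_padR_leftMul h h'
      right_right := isRegular_padR_rightMul h }⟩, ⟨A, toOneRelator u v, normalSet u,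
    { hreg with
      right_right := isRegular_padR_rightMul h
      pref := isRegular_prefixRel h }⟩⟩

end Structures

end Semigroup
end OneRelator
namespace OneRelator

/-! ### Conditions on the words that force rewriting to move leftwards. -/

section Combinatorics

variable {A : Type*}

/-- No nonempty proper prefix of the word is also a suffix. -/
def Borderless (u : List A) : Prop :=
  ∀ o p q : List A, o ≠ [] → p ≠ [] → q ≠ [] → u = o ++ p → u = q ++ o → False

theorem Borderless.reverse {u : List A} (h : Borderless u) : Borderless u.reverse := by
  intro o p q ho hp hq e1 e2
  refine h o.reverse q.reverse p.reverse (by simpa) (by simpa) (by simpa) ?_ ?_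
  · rw [← List.reverse_append, ← e2, List.reverse_reverse]
  · rw [← List.reverse_append, ← e1, List.reverse_reverse]

theorem borderless_of_nodup {u : List A} (h : u.Nodup) : Borderless u := by
  rintro o p q ho hp hq e1 e2
  rcases o with _ | ⟨a, o⟩
  · exact ho rfl
  rcases q with _ | ⟨b, q⟩
  · exact hq rfl
  have : a = b := by
    rw [e1] at e2
    simp only [List.cons_append, List.cons.injEq] at e2
    exact e2.1
  subst this
  rw [e2] at h
  simp at h

/-- A border that overlaps itself yields a shorter border, so descent reaches one whose two copies
are disjoint, that is, a form `ww'w`. -/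
theorem borderless_of_forall_ne {u : List A}
    (h : ∀ w w' : List A, w ≠ [] → u ≠ w ++ w' ++ w) : Borderless u := by
  suffices ∀ (n : ℕ) (o p q : List A), o.length ≤ n → o ≠ [] → p ≠ [] → q ≠ [] → u = o ++ p →
      u = q ++ o → False from fun o p q => this o.length o p q le_rfl
  intro n
  induction n with
  | zero =>
    intro o p q hn ho
    exact absurd (List.eq_nil_of_length_eq_zero (by omega)) ho
  | succ n ih =>
    intro o p q hn ho hp hq e1 e2
    have hql : 0 < q.length := List.length_pos_iff.2 hq
    rcases List.append_eq_append_iff.1 (e1.symm.trans e2) with ⟨m, rfl, rfl⟩ | ⟨o₁, rfl, e3⟩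
    · exact h o m ho e2
    · rcases eq_or_ne o₁ [] with rfl | ho₁
      · refine h q [] hq ?_
        simpa using e2
      · refine ih o₁ (p ++ p) (q ++ q) ?_ ho₁ (by simp [hp]) (by simp [hq]) ?_ ?_
        · simp only [List.length_append] at hn
          omega
        · rw [e1, e3, List.append_assoc]
        · rw [e2, List.append_assoc]

theorem rewritesLeftwards_of_no_overlap {u v : List A}
    (h : ∀ s z r : List A, s ≠ [] → u = s ++ z → v = r ++ s → False) : RewritesLeftwards u v :=
  fun _ _ _ s z r _ _ _ _ _ _ e1 e2 hs _ _ _ => h s z r hs e1 e2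

/-- The letter `b` of `u` cannot lie in the part `s` of `v`, so it lies in `z`, a prefix of `v'Y`,
all of whose letters occur in `v`. This is the purpose of the clause on the letters of `Y`. -/
theorem rewritesLeftwards_of_not_mem {u v : List A} {b : A} (hu : b ∈ u) (hv : b ∉ v) :
    RewritesLeftwards u v := by
  rintro x y v' s z r Y W - rfl - - rfl e - - e' hY
  have hs : b ∉ s := fun h => hv (by rw [e]; exact List.mem_append_right _ h)
  have hz : b ∈ z := (List.mem_append.1 hu).resolve_left hs
  rcases List.mem_append.1 (e' ▸ List.mem_append_left W hz : b ∈ v' ++ Y) with h | h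
  · exact hv (List.mem_append_right _ h)
  · exact hv (hY b h)

/-- The configuration forces `v = yms` and `u = smy`, with one of `s`, `y` a prefix of the other.
Hence `s` is a border of `v` that occurs twice in `u`, or `y` is a border of `u`. -/
theorem rewritesLeftwards_of_borderless {u v : List A} (hl : u.length = v.length)
    (hu : Borderless u) (h : Borderless v ∨ u.Nodup) : RewritesLeftwards u v := by
  intro x y v' s z r Y W exy ev hx hy esz ers hs hz eW _
  -- If `y` and `s` overlapped inside `v`, the overlap would be a suffix of `y` and a prefix of `s`,
  -- hence a border of `u`.
  obtain ⟨m, rfl, rfl⟩ : ∃ m, r = y ++ m ∧ v' = m ++ s := by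
    rcases List.append_eq_append_iff.1 (ev.symm.trans ers) with ⟨m, h1, h2⟩ | ⟨o, rfl, rfl⟩
    · exact ⟨m, h1, h2⟩
    · rcases eq_or_ne o [] with rfl | ho
      · exact ⟨[], by simp, by simp⟩
      · exact (hu o (v' ++ z) (x ++ r) ho (by simp [hz]) (by simp [hx])
          (by rw [esz, List.append_assoc]) (by rw [exy, List.append_assoc])).elim
  have hlen : z.length = m.length + y.length := by
    have h1 := congrArg List.length esz
    have h2 := congrArg List.length ers
    simp only [List.length_append] at h1 h2
    omega
  obtain ⟨y', rfl, e3⟩ : ∃ y', z = m ++ y' ∧ s ++ Y = y' ++ W := by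
    rw [List.append_assoc] at eW
    rcases List.append_eq_append_iff.1 eW with ⟨y', h1, h2⟩ | ⟨y', h1, h2⟩
    · exact ⟨y', h1, h2⟩
    · have := congrArg List.length h1
      simp only [List.length_append] at this
      exact absurd (List.eq_nil_of_length_eq_zero (by omega)) hy
  have hyy : y' = y := by
    rw [esz, ← List.append_assoc] at exy
    exact List.append_inj_right' exy (by simpa using hlen)
  subst hyy
  rcases List.append_eq_append_iff.1 e3 with ⟨c, rfl, -⟩ | ⟨c, rfl, -⟩
  · rcases h with h | h
    · exact h s (c ++ m ++ s) (s ++ c ++ m) hs (by simp [hs]) (by simp [hs])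
        (by rw [ev]; simp) (by rw [ers])
    · rw [esz] at h
      obtain ⟨a, s, rfl⟩ := List.exists_cons_of_ne_nil hs
      simp at h
  · exact hu y' (c ++ m ++ y') (y' ++ c ++ m) hy (by simp [hy]) (by simp [hy])
      (by rw [esz]; simp) (by rw [esz]; simp)

/-- The word `aaa` has two rewritings. For `v = ad` they lead to the distinct normal forms `ada` and
`add`, for `v = ca` to `cca` and `aca`. -/
theorem eq_of_length_two_overlap {a : A} {v : List A} (hv : v.length = 2) (ha : a ∈ v)
    (hne : [a, a] ≠ v)
    (hU : ∀ x y, Irr [a, a] x → Irr [a, a] y → Conv [a, a] v x y → x = y) : False := by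
  obtain ⟨c, d, rfl⟩ := List.length_eq_two.1 hv
  have s1 : Conv [a, a] [c, d] [a, a, a] [c, d, a] := .rel _ _ ⟨[], [a], rfl, rfl⟩
  have s2 : Conv [a, a] [c, d] [a, a, a] [a, c, d] := .rel _ _ ⟨[a], [], rfl, rfl⟩
  have s := Relation.EqvGen.trans _ _ _ (.symm _ _ s1) s2
  by_cases hc : a = c
  · subst hc
    have hd : a ≠ d := fun h => hne (by rw [h])
    have s3 : Conv [a, a] [a, d] [a, a, d] [a, d, d] := .rel _ _ ⟨[], [d], rfl, rfl⟩
    have := hU [a, d, a] [a, d, d] (by simp [Irr, List.infix_cons_iff, hd])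
      (by simp [Irr, List.infix_cons_iff, hd]) (.trans _ _ _ s s3)
    simp [hd] at this
  · have hd : a = d := by simpa [hc] using ha
    subst hd
    have s3 : Conv [a, a] [c, a] [c, a, a] [c, c, a] := .rel _ _ ⟨[c], [], rfl, rfl⟩
    have := hU [c, c, a] [a, c, a] (by simp [Irr, List.infix_cons_iff, hc])
      (by simp [Irr, List.infix_cons_iff, hc]) (.trans _ _ _ (.symm _ _ s3) s)
    simp [Ne.symm hc] at this

theorem nodup_of_ncard_con {u : List A} (h : (con u).ncard = u.length) : u.Nodup := by
  classical
  have e : con u = (u.toFinset : Set A) := by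
    ext a
    simp [con]
  rw [e, Set.ncard_coe_finset, List.card_toFinset] at h
  exact (List.dedup_sublist u).eq_of_length h ▸ List.nodup_dedup u

end Combinatorics

/-! ### From trivial compositions to resolved overlaps. -/

section GroebnerShirshovBasis

open MonoidAlgebra

variable {A F : Type*} [Field F] {u v : FreeSemigroup A}

theorem coeff_relatorPoly (x : FreeMonoid A) [DecidableEq (FreeMonoid A)] :
    (relatorPoly F u v).coeff x = (if FreeMonoid.ofList (word u) = x then 1 else 0) -
      if FreeMonoid.ofList (word v) = x then 1 else 0 := by
  simp [relatorPoly, MonoidAlgebra.of_apply, Finsupp.single_apply]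

variable [LinearOrder A]

theorem isLeadingWord_relatorPoly_iff
    (h : WordDegLex (FreeMonoid.ofList (word v)) (FreeMonoid.ofList (word u)))
    {w : FreeMonoid A} :
    IsLeadingWord WordDegLex (relatorPoly F u v) w ↔ w = FreeMonoid.ofList (word u) := by
  classical
  have hasymm : ∀ x y : FreeMonoid A, WordDegLex x y → ¬ WordDegLex y x :=
    fun x y => (List.Shortlex.asymm (r := ((· < ·) : A → A → Prop))).asymm _ _
  have hne : FreeMonoid.ofList (word u) ≠ FreeMonoid.ofList (word v) := by
    intro e
    rw [e] at h
    exact hasymm _ _ h h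
  have hsupp : ∀ x, x ∈ (relatorPoly F u v).coeff.support ↔
      x = FreeMonoid.ofList (word u) ∨ x = FreeMonoid.ofList (word v) := by
    intro x
    rw [Finsupp.mem_support_iff, coeff_relatorPoly]
    by_cases h1 : FreeMonoid.ofList (word u) = x
    · subst h1
      simp [hne.symm]
    · by_cases h2 : FreeMonoid.ofList (word v) = x
      · subst h2
        simp [hne]
      · simp [h1, h2, Ne.symm h1, Ne.symm h2]
  constructor
  · rintro ⟨h1, h2⟩
    by_contra hw
    have hwv := ((hsupp w).1 h1).resolve_left hw
    have := h2 _ ((hsupp _).2 (Or.inl rfl)) (Ne.symm hw)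
    rw [hwv] at this
    exact hasymm _ _ h this
  · rintro rfl
    refine ⟨(hsupp _).2 (Or.inl rfl), fun x hx hxu => ?_⟩
    rw [((hsupp x).1 hx).resolve_left hxu]
    exact h

/-- A linear combination is turned into a chain of rewritings by a linear functional that is
constant on the classes of rewriting below `uq`. It kills every `a(u - v)b` with `aub < uq`, hence
the composition, so it takes equal values at `vq` and `pv`. -/
theorem criticalPairsResolve_of_isGroebnerShirshovBasis
    (h : WordDegLex (FreeMonoid.ofList (word v)) (FreeMonoid.ofList (word u)))
    (hGS : IsGroebnerShirshovBasis WordDegLex {relatorPoly F u v}) :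
    CriticalPairsResolve (· < ·) (word u) (word v) := by
  classical
  intro p q e hq
  have hlead := (isLeadingWord_relatorPoly_iff (F := F) h).2 rfl
  have htriv := hGS.intersection _ rfl _ rfl _ _ (FreeMonoid.ofList p) (FreeMonoid.ofList q)
    (FreeMonoid.ofList (word u ++ q)) hlead hlead (FreeMonoid.ofList_append _ _)
    (by rw [e]; exact FreeMonoid.ofList_append _ _)
    (by
      change (word u ++ q).length < (word u).length + (word u).length
      rw [List.length_append]
      omega)
  set E := Relation.EqvGen (fun x y => ∃ c d, x = c ++ word u ++ d ∧ y = c ++ word v ++ d ∧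
    List.Shortlex (· < ·) x (word u ++ q))
  -- The indicator of the class of `vq`: it equals `1` at `vq`, so its being `1` at `pv` says that
  -- the overlap resolves.
  let g : FreeMonoid A → F := fun x => if E (word v ++ q) x.toList then 1 else 0
  let T : MonoidAlgebra F (FreeMonoid A) →ₗ[F] F :=
    (Finsupp.linearCombination F g).comp (coeffLinearEquiv F).toLinearMap
  have hT : ∀ x, T (of F (FreeMonoid A) x) = g x := by
    intro x
    change Finsupp.linearCombination F g (Finsupp.single x 1) = g x
    simp
  have hker : ∀ f, IsTrivialModulo WordDegLex {relatorPoly F u v}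
      (FreeMonoid.ofList (word u ++ q)) f → T f = 0 := by
    intro f hf
    refine LinearMap.mem_ker.1 ((Submodule.span_le (p := LinearMap.ker T)).2 ?_ hf)
    rintro _ ⟨s, rfl, s', a, b, hs', hlt, rfl⟩
    rw [(isLeadingWord_relatorPoly_iff h).1 hs'] at hlt
    rw [SetLike.mem_coe, LinearMap.mem_ker, relatorPoly, mul_sub, sub_mul, map_sub,
      ← map_mul, ← map_mul, ← map_mul, ← map_mul, hT, hT, sub_eq_zero]
    have hE : E (a.toList ++ word u ++ b.toList) (a.toList ++ word v ++ b.toList) :=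
      .rel _ _ ⟨_, _, rfl, rfl, hlt⟩
    have : E (word v ++ q) (a.toList ++ word u ++ b.toList) ↔
        E (word v ++ q) (a.toList ++ word v ++ b.toList) :=
      ⟨fun h => .trans _ _ _ h hE, fun h => .trans _ _ _ h (.symm _ _ hE)⟩
    exact if_congr this rfl rfl
  have hz := hker _ htriv
  have hexp : relatorPoly F u v * of F (FreeMonoid A) (FreeMonoid.ofList q) -
      of F (FreeMonoid A) (FreeMonoid.ofList p) * relatorPoly F u v =
      of F (FreeMonoid A) (FreeMonoid.ofList (p ++ word v)) -
      of F (FreeMonoid A) (FreeMonoid.ofList (word v ++ q)) := by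
    rw [relatorPoly, sub_mul, mul_sub, ← map_mul (of F _), ← map_mul (of F _),
      ← map_mul (of F _), ← map_mul (of F _), ← FreeMonoid.ofList_append, ← FreeMonoid.ofList_append, ← FreeMonoid.ofList_append,
      ← FreeMonoid.ofList_append, e]
    abel
  rw [hexp, map_sub, hT, hT, sub_eq_zero] at hz
  have h1 : g (FreeMonoid.ofList (word v ++ q)) = 1 := if_pos (.refl _)
  rw [h1] at hz
  by_contra hcon
  have h0 : g (FreeMonoid.ofList (p ++ word v)) = 0 := if_neg hcon
  rw [h0] at hz
  exact zero_ne_one hz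

end GroebnerShirshovBasis

/-- The reversed statement serves left multiplication. Borderlessness, distinctness of letters and
missing letters are invariant under reversal, while the two halves of the first condition serve one
direction each. -/
theorem rewritesLeftwards_and_reverse {A : Type*} {u v : List A} (hl : u.length = v.length)
    (hne : u ≠ v) (hU : ∀ x y, Irr u x → Irr u y → Conv u v x y → x = y)
    (h :
      (∀ t : ℕ, 1 ≤ t → pre v t ≠ suf u t ∧ suf v t ≠ pre u t) ∨
      (con u).ncard = u.length ∨ u.length = 2 ∨ ¬ con u ⊆ con v ∨
      ((∀ w w' : List A, w ≠ [] → u ≠ w ++ w' ++ w) ∧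
        (∀ s s' : List A, s ≠ [] → v ≠ s ++ s' ++ s))) :
    RewritesLeftwards u v ∧ RewritesLeftwards u.reverse v.reverse := by
  have hl' : u.reverse.length = v.reverse.length := by simpa using hl
  have nodup : u.Nodup → RewritesLeftwards u v ∧ RewritesLeftwards u.reverse v.reverse :=
    fun hu => ⟨rewritesLeftwards_of_borderless hl (borderless_of_nodup hu) (Or.inr hu),
      rewritesLeftwards_of_borderless hl' (borderless_of_nodup hu).reverse
        (Or.inr (List.nodup_reverse.2 hu))⟩
  have notMem : ∀ b ∈ u, b ∉ v → RewritesLeftwards u v ∧ RewritesLeftwards u.reverse v.reverse :=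
    fun b hu hv => ⟨rewritesLeftwards_of_not_mem hu hv,
      rewritesLeftwards_of_not_mem (List.mem_reverse.2 hu) (mt List.mem_reverse.1 hv)⟩
  rcases h with h | h | h | h | ⟨h1, h2⟩
  · constructor
    · refine rewritesLeftwards_of_no_overlap fun s z r hs e1 e2 => ?_
      refine (h s.length (List.length_pos_iff.2 hs)).2 ?_
      simp [pre, suf, e1, e2]
    · refine rewritesLeftwards_of_no_overlap fun s z r hs e1 e2 => ?_
      rw [List.reverse_eq_iff, List.reverse_append] at e1 e2
      refine (h s.length (List.length_pos_iff.2 hs)).1 ?_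
      rw [e1, e2]
      simp [pre, suf]
  · exact nodup (nodup_of_ncard_con h)
  · obtain ⟨a, b, rfl⟩ := List.length_eq_two.1 h
    by_cases hab : a = b
    · subst hab
      -- Here `u = aa` has a border. Uniqueness of normal forms excludes `a ∈ v`, and otherwise `a`
      -- is a letter of `u` missing from `v`.
      by_cases ha : a ∈ v
      · exact (eq_of_length_two_overlap hl.symm ha hne hU).elim
      · exact notMem a (by simp) ha
    · exact nodup (by simp [hab])
  · obtain ⟨b, hu, hv⟩ := Set.not_subset.1 h
    exact notMem b hu hv
  · exact ⟨rewritesLeftwards_of_borderless hl (borderless_of_forall_ne h1)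
        (Or.inl (borderless_of_forall_ne h2)),
      rewritesLeftwards_of_borderless hl' (borderless_of_forall_ne h1).reverse
        (Or.inl (borderless_of_forall_ne h2).reverse)⟩

end OneRelator

theorem theorem3p1p3 {A : Type*} [Finite A] [LinearOrder A] {F : Type*} [Field F]
    (k : ℕ) (hk : 2 ≤ k) (u v : FreeSemigroup A)
    (hu : u.length = k) (hv : v.length = k)
    (hvu : OneRelator.WordDegLex (FreeMonoid.ofList (OneRelator.word v))
      (FreeMonoid.ofList (OneRelator.word u)))
    (hGS : OneRelator.IsGroebnerShirshovBasis OneRelator.WordDegLex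
      {OneRelator.relatorPoly F u v})
    (h :
      (∀ t : ℕ, 1 ≤ t →
        OneRelator.pre (OneRelator.word v) t ≠ OneRelator.suf (OneRelator.word u) t ∧
        OneRelator.suf (OneRelator.word v) t ≠ OneRelator.pre (OneRelator.word u) t) ∨
      (OneRelator.con (OneRelator.word u)).ncard = k ∨
      k = 2 ∨
      ¬ OneRelator.con (OneRelator.word u) ⊆ OneRelator.con (OneRelator.word v) ∨
      ((∀ w w' : List A, w ≠ [] → OneRelator.word u ≠ w ++ w' ++ w) ∧
        (∀ s s' : List A, s ≠ [] → OneRelator.word v ≠ s ++ s' ++ s))) :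
    OneRelator.IsBiautomatic (OneRelator.OneRelatorSemigroup u v) ∧
      OneRelator.IsPrefixAutomatic (OneRelator.OneRelatorSemigroup u v) := by
  have hwf : WellFounded ((· < ·) : A → A → Prop) := wellFounded_lt
  have hlt : List.Shortlex (· < ·) (OneRelator.word v) (OneRelator.word u) := hvu
  have hl : (OneRelator.word u).length = (OneRelator.word v).length := by
    rw [OneRelator.length_word, OneRelator.length_word, hu, hv]
  have hne : OneRelator.word u ≠ OneRelator.word v := by
    intro e
    rw [e] at hlt
    exact (List.Shortlex.asymm (r := ((· < ·) : A → A → Prop))).asymm _ _ hlt hlt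
  have hU : ∀ x y, OneRelator.Irr (OneRelator.word u) x → OneRelator.Irr (OneRelator.word u) y →
      OneRelator.Conv (OneRelator.word u) (OneRelator.word v) x y → x = y := fun x y =>
    OneRelator.irr_unique hwf hlt
      (OneRelator.criticalPairsResolve_of_isGroebnerShirshovBasis hvu hGS)
  have hk' : (OneRelator.word u).length = k := hu
  rw [← hk'] at h
  obtain ⟨h1, h2⟩ := OneRelator.rewritesLeftwards_and_reverse hl hne hU h
  refine OneRelator.isBiautomatic_and_isPrefixAutomatic ⟨hl, hne, h1, hU⟩
    ⟨by simpa using hl, by simpa using hne, h2, fun x y hx hy hxy => ?_⟩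
    (OneRelator.exists_irr hwf hlt)
  rw [← x.reverse_reverse, OneRelator.irr_reverse_iff] at hx
  rw [← y.reverse_reverse, OneRelator.irr_reverse_iff] at hy
  rw [← x.reverse_reverse, ← y.reverse_reverse, OneRelator.conv_reverse_iff] at hxy
  exact List.reverse_injective (hU _ _ hx hy hxy)
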